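/- A graphon is a symmetric Lebesgue measurable function $W:[0,1]^2\to[0,1]$. Let $A_W$ be the operator $(A_Wf)(x)=\int_0^1 W(x,y)f(y)\,dy$ on $L^2[0,1]$, let $\mu(W)$ and $\nu(W)$ be the supremum and the infimum of its set of eigenvalues (the maximum and the minimum eigenvalue), and let $\mathrm{spr}(W)=\mu(W)-\nu(W)$. Suppose that $W$ is a graphon with $\mathrm{spr}(U)\le \mathrm{spr}(W)$ for every graphon $U$. Then, up to relabeling, $W$ is a stepfunction with values $0$ and $1$ and at most $7\times 7$ blocks, of the following form. Let $$M=\left(\begin{array}{cccc|ccc} 1&1&1&1&1&1&1\\ 1&1&1&0&1&1&1\\ 1&1&0&0&1&1&1\\ 1&0&0&0&1&1&1\\ \hline 1&1&1&1&1&1&0\\ 1&1&1&1&1&0&0\\ 1&1&1&1&0&0&0 \end{array}\right).$$ There are real numbers $0=t_0\le t_1\le\dots\le t_7=1$ and a measure-preserving map $\varphi:[0,1]\to[0,1]$ such that, with $J_i=[t_{i-1},t_i)$ for $1\le i\le 7$ (some of these intervals may be empty), for almost every $(x,y)\in[0,1]^2$ $$W(x,y)=M_{ij}\quad\text{where } \varphi(x)\in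 J_i,\ \varphi(y)\in J_j .$$ Furthermore, the division of the indices into $\{1,2,3,4\}$ and $\{5,6,7\}$ is according to the sign of the eigenfunction for $\nu(W)$: an eigenfunction of $A_W$ for $\nu(W)$ exists, and for every such eigenfunction $g$ one of the functions $h=g$, $h=-g$ satisfies, for almost every $x$, $h(x)\ge 0$ if $\varphi(x)\in J_1\cup J_2\cup J_3\cup J_4$ and $h(x)<0$ if $\varphi(x)\in J_5\cup J_6\cup J_7$. -/

import Mathlib

open MeasureTheory
open scoped unitInterval

noncomputable section

/-- A graphon: a symmetric Lebesgue measurable function `W : [0,1]² → [0,1]`.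
Measurability is `AEMeasurable` with respect to (two-dimensional) Lebesgue measure, which on the
Borel space `[0,1]²` is exactly Lebesgue measurability. -/
structure Graphon where
  toFun : I → I → ℝ
  aemeasurable' : AEMeasurable (fun p : I × I => toFun p.1 p.2) volume
  symm' : ∀ x y, toFun x y = toFun y x
  mem_Icc' : ∀ x y, toFun x y ∈ Set.Icc (0 : ℝ) 1

namespace Graphon

/-- The integral operator of a graphon: `(A_W f)(x) = ∫ W(x,y) f(y) dy`. -/
def op (W : Graphon) (f : I → ℝ) (x : I) : ℝ :=
  ∫ y, W.toFun x y * f y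

/-- `f` is an eigenfunction of the operator `A_W` on `L²[0,1]` for the eigenvalue `c`: it is
square integrable, not a.e. zero, and `A_W f = c f` almost everywhere. -/
def IsEigenfunction (W : Graphon) (c : ℝ) (f : I → ℝ) : Prop :=
  MemLp f 2 volume ∧ ¬ (f =ᵐ[volume] 0) ∧ ∀ᵐ x : I, W.op f x = c * f x

/-- The set of eigenvalues of `A_W` on `L²[0,1]`. -/
def eigenvalues (W : Graphon) : Set ℝ :=
  {c | ∃ f : I → ℝ, W.IsEigenfunction c f}

/-- The maximum eigenvalue `μ(W)`. -/
def maxEigenvalue (W : Graphon) : ℝ := sSup W.eigenvalues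

/-- The minimum eigenvalue `ν(W)`. -/
def minEigenvalue (W : Graphon) : ℝ := sInf W.eigenvalues

/-- The spread of a graphon. -/
def spread (W : Graphon) : ℝ := W.maxEigenvalue - W.minEigenvalue

/-- The fixed `7 × 7` pattern: the join of two threshold patterns, the first on the first four
indices, the second on the last three. -/
def pattern : Matrix (Fin 7) (Fin 7) ℝ :=
  !![1, 1, 1, 1, 1, 1, 1;
     1, 1, 1, 0, 1, 1, 1;
     1, 1, 0, 0, 1, 1, 1;
     1, 0, 0, 0, 1, 1, 1;
     1, 1, 1, 1, 1, 1, 0;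
     1, 1, 1, 1, 1, 0, 0;
     1, 1, 1, 1, 0, 0, 0]

/-- Seven consecutive (possibly empty) intervals with end points `0 = t 0 ≤ t 1 ≤ ⋯ ≤ t 7 = 1`. -/
def IsCuts (t : Fin 8 → ℝ) : Prop :=
  Monotone t ∧ t 0 = 0 ∧ t 7 = 1

/-- The `i`-th interval `[t i, t (i + 1))`, as a subset of `[0,1]`. -/
def block (t : Fin 8 → ℝ) (i : Fin 7) : Set I :=
  {x | t i.castSucc ≤ (x : ℝ) ∧ (x : ℝ) < t i.succ}

/-- The stepfunction with value `pattern i j` on `block t i × block t j`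
(the blocks cover all of `[0,1]` but the point `1`). -/
def step (t : Fin 8 → ℝ) (x y : I) : ℝ :=
  ∑ i, ∑ j, pattern i j * (block t i).indicator 1 x * (block t j).indicator 1 y

end Graphon

end

/-!
Let `W` have maximal spread, and let `f ≥ 0` and `g` be unit eigenfunctions for `μ = μ(W)` and
`ν = ν(W)`. All information comes from comparing `W` with other graphons by trial functions: for
bounded `u`, `v`, the difference of the Rayleigh quotients of `u` and `v` for any graphon `U` is at most
`spr(U) ≤ spr(W) = μ - ν`.

* Changing the values of `W`: as `μ - ν = ∬ W(x,y) (f(x) f(y) - g(x) g(y))`, the kernel `W` is `1` where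
  `f(x) f(y) > g(x) g(y)` and `0` where `f(x) f(y) < g(x) g(y)`. Equality holds only on a null set, and
  `f > 0` (`IsExtremal.ae_gap_ne_zero`, `IsExtremal.ae_pos`). So with the ratio `r = g / f`, points `x`,
  `y` are adjacent if and only if `r(x) r(y) < 1`. Points with ratios of opposite signs are always
  adjacent, and on each of the two sides `r ≥ 0`, `r < 0` one sees a threshold graphon.
* Changing the weights of the points: reweighting the interval by a density `1 + ε d` is the same as
  pulling `W` back along a map. The first variation gives `μ f² - ν g² = μ - ν`
  (`IsExtremal.ae_ellipse`); in particular `f` and `g` are determined by `r`, and `ν` is a simple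
  eigenvalue. The second variation (`IsExtremal.ae_op_mul_eq_zero`) says that `A_W (d f) = 0` whenever
  `d` is orthogonal to `1` and to `f²` and `⟨A_W (d f), d f⟩ ≥ ⟨A_W (d g), d g⟩`.

The second variation makes the number of classes finite. Call `|r(x)|` the level of `x`, and let `s` be
the top level of one side. If a point of level in `[1/s, 1)` were not adjacent to one of level in
`[1, s)` on the same side, these two and the top level would provide three sets of points with too few
adjacencies among them, and a combination `d` of their indicator functions would violate the second
variation (`IsExtremal.not_three_levels`). Hence adjacency only depends on which of the classes
`[0, 1/s)`, `[1/s, 1)`, `[1, s)`, `[s, ∞)` the levels belong to, and does so by the rule of the pattern.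
A point of the lowest class is adjacent to everything, so that `ν g(x) = ∫ g` there. If the sign of `g`
is chosen such that `∫ g ≤ 0`, this class therefore occurs only where `g ≥ 0`, which leaves four classes
on one side and three on the other. A rearrangement turns the classes into intervals
(`exists_measurePreserving_block`).

The preliminaries are the existence of the extremal eigenfunctions, from the complete continuity of
`A_W`, and the fact that the maximal spread exceeds `1`, which implies `ν < 0 < μ`.
-/

open Filter Topology

/-! ### Eigenvalues of the operator of a graphon -/

/-- A self-adjoint operator that maps weakly convergent sequences of the unit ball to norm convergent
ones, and whose quadratic form is positive somewhere, has a positive eigenvalue that bounds the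
quadratic form: a maximizing sequence of the form on the unit ball has a weakly convergent
subsequence, whose limit is a maximizer. -/
theorem exists_eigenvector_of_inner_pos {H : Type*} [NormedAddCommGroup H] [InnerProductSpace ℝ H]
    [CompleteSpace H] [TopologicalSpace.SeparableSpace H] (T : H →L[ℝ] H) (hT : IsSelfAdjoint T)
    (hc : ∀ (u : ℕ → H) (x : H), (∀ n, ‖u n‖ ≤ 1) →
      (∀ v, Tendsto (fun n => inner ℝ (u n) v) atTop (𝓝 (inner ℝ x v))) →
      Tendsto (fun n => T (u n)) atTop (𝓝 (T x)))
    (w : H) (hw : 0 < inner ℝ (T w) w) :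
    ∃ c : ℝ, 0 < c ∧ (∃ x, x ≠ 0 ∧ T x = c • x) ∧ ∀ v, inner ℝ (T v) v ≤ c * ‖v‖ ^ 2 := by
  have hsym : ∀ x y, inner ℝ (T x) y = inner ℝ x (T y) := fun x y =>
    hT.isSymmetric x y
  set J : H → ℝ := fun v => inner ℝ (T v) v with hJ
  set S : Set ℝ := J '' Metric.closedBall 0 1 with hS
  have hbdd : BddAbove S := by
    refine ⟨‖T‖, ?_⟩
    rintro _ ⟨v, hv, rfl⟩
    have hv1 : ‖v‖ ≤ 1 := by simpa using hv
    calc J v ≤ ‖T v‖ * ‖v‖ := real_inner_le_norm _ _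
      _ ≤ (‖T‖ * ‖v‖) * ‖v‖ := by gcongr; exact T.le_opNorm v
      _ ≤ (‖T‖ * 1) * 1 := by gcongr
      _ = ‖T‖ := by ring
  have hne : S.Nonempty := ⟨J 0, 0, by simp, rfl⟩
  have hscale : ∀ v, v ≠ 0 → J v ≤ sSup S * ‖v‖ ^ 2 := by
    intro v hv
    have hv0 : 0 < ‖v‖ := norm_pos_iff.2 hv
    have h1 : J (‖v‖⁻¹ • v) ≤ sSup S := by
      refine le_csSup hbdd ⟨_, ?_, rfl⟩
      simp [norm_smul, hv0.ne']
    have h2 : J (‖v‖⁻¹ • v) = J v / ‖v‖ ^ 2 := by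
      simp only [hJ, map_smul, inner_smul_left, inner_smul_right]
      simp; field_simp
    rw [h2, div_le_iff₀ (by positivity)] at h1
    exact h1
  have hw0 : w ≠ 0 := by rintro rfl; simp at hw
  have hM : 0 < sSup S := by
    by_contra h
    push Not at h
    have := hscale w hw0
    have h3 : sSup S * ‖w‖ ^ 2 ≤ 0 := mul_nonpos_of_nonpos_of_nonneg h (by positivity)
    exact absurd hw (not_lt.2 (this.trans h3))
  obtain ⟨s, hs_mono, hs_tend, hs_mem⟩ := exists_seq_tendsto_sSup hne hbdd
  choose u hu hus using hs_mem
  have hu1 : ∀ n, ‖u n‖ ≤ 1 := fun n => by simpa using hu n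
  -- weak sequential compactness of the unit ball
  obtain ⟨ℓ, -, φ, hφ, hlim⟩ := WeakDual.isSeqCompact_closedBall ℝ H (0 : StrongDual ℝ H) 1
    (x := fun n => StrongDual.toWeakDual (InnerProductSpace.toDual ℝ H (u n))) (by
      intro n
      simpa using hu1 n)
  set x : H := (InnerProductSpace.toDual ℝ H).symm (WeakDual.toStrongDual ℓ) with hx
  have hweak : ∀ v, Tendsto (fun n => inner ℝ (u (φ n)) v) atTop (𝓝 (inner ℝ x v)) := by
    intro v
    have h1 := (WeakDual.eval_continuous (𝕜 := ℝ) v).continuousAt.tendsto.comp hlim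
    have h2 : inner ℝ x v = ℓ v := by
      rw [hx, InnerProductSpace.toDual_symm_apply]; rfl
    rw [h2]
    exact h1
  have hstrong := hc (fun n => u (φ n)) x (fun n => hu1 _) hweak
  have hxn : ‖x‖ ≤ 1 := by
    have h1 : inner ℝ x x ≤ 1 * ‖x‖ := by
      refine le_of_tendsto (hweak x) (Eventually.of_forall fun n => ?_)
      exact (real_inner_le_norm _ _).trans (by gcongr; exact hu1 _)
    rw [real_inner_self_eq_norm_sq] at h1
    nlinarith [norm_nonneg x]
  have hJlim : Tendsto (fun n => J (u (φ n))) atTop (𝓝 (J x)) := by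
    have h1 : Tendsto (fun n => inner ℝ (T (u (φ n)) - T x) (u (φ n))) atTop (𝓝 0) := by
      refine squeeze_zero_norm (a := fun n => ‖T (u (φ n)) - T x‖) (fun n => ?_) ?_
      · refine (norm_inner_le_norm _ _).trans ?_
        exact mul_le_of_le_one_right (norm_nonneg _) (hu1 _)
      · exact tendsto_iff_norm_sub_tendsto_zero.1 hstrong
    have h2 := h1.add (hweak (T x))
    rw [zero_add] at h2
    have h3 : inner ℝ x (T x) = J x := (hsym x x).symm
    rw [h3] at h2
    refine h2.congr fun n => ?_
    rw [inner_sub_left, real_inner_comm (T x) (u (φ n))]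
    simp only [hJ]
    rw [real_inner_comm (u (φ n)) (T x)]
    ring
  have hJx : J x = sSup S := by
    refine tendsto_nhds_unique hJlim ?_
    refine (hs_tend.comp hφ.tendsto_atTop).congr fun n => ?_
    exact (hus (φ n)).symm
  have hx0 : x ≠ 0 := by
    intro h
    rw [h] at hJx
    simp [hJ] at hJx
    exact hM.ne hJx
  have hle : ∀ v, J v ≤ sSup S * ‖v‖ ^ 2 := by
    intro v
    by_cases hv : v = 0
    · subst hv; simp [hJ]
    · exact hscale v hv
  have hxnorm : ‖x‖ = 1 := by
    have h1 := hle x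
    rw [hJx] at h1
    have : 1 ≤ ‖x‖ ^ 2 := by
      by_contra h
      push Not at h
      nlinarith
    nlinarith [norm_nonneg x]
  have hmax : IsMaxOn T.reApplyInnerSelf (Metric.sphere (0 : H) ‖x‖) x := by
    intro v hv
    have hv1 : ‖v‖ = 1 := by simpa [hxnorm] using hv
    have := hle v
    rw [hv1] at this
    simp only [ContinuousLinearMap.reApplyInnerSelf_apply, Set.mem_ofPred_eq]
    simp only [RCLike.re_to_real]
    change J v ≤ J x
    rw [hJx]; linarith
  have heig := IsSelfAdjoint.eq_smul_self_of_isLocalExtrOn (𝕜 := ℝ) hT (x₀ := x) (Or.inr hmax.localize)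
  refine ⟨sSup S, hM, ⟨x, hx0, ?_⟩, hle⟩
  have hq : T.rayleighQuotient x = sSup S := by
    simp only [ContinuousLinearMap.rayleighQuotient, ContinuousLinearMap.reApplyInnerSelf_apply,
      hxnorm]
    simpa using hJx
  rw [hq] at heig
  simpa using heig

namespace Graphon

variable (U : Graphon)

theorem op_congr {f g : I → ℝ} (h : f =ᵐ[volume] g) : U.op f = U.op g := by
  funext x
  exact integral_congr_ae (h.mono fun y hy => by simp [hy])

theorem measurable_right (hU : Measurable fun p : I × I => U.toFun p.1 p.2) (x : I) :
    Measurable (U.toFun x) :=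
  hU.comp measurable_prodMk_left

theorem abs_le_one (x y : I) : |U.toFun x y| ≤ 1 := by
  have := U.mem_Icc' x y
  rw [abs_le]; constructor <;> linarith [this.1, this.2]

theorem integrable_mul (hU : Measurable fun p : I × I => U.toFun p.1 p.2) {f : I → ℝ}
    (hf : Integrable f) (x : I) : Integrable fun y => U.toFun x y * f y :=
  hf.bdd_mul (c := 1) (U.measurable_right hU x).aestronglyMeasurable
    (Eventually.of_forall fun y => by simpa using U.abs_le_one x y)

theorem abs_op_le (hU : Measurable fun p : I × I => U.toFun p.1 p.2) {f : I → ℝ}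
    (hf : Integrable f) (x : I) : |U.op f x| ≤ ∫ y, |f y| := by
  refine (abs_integral_le_integral_abs).trans ?_
  refine integral_mono (U.integrable_mul hU hf x).abs hf.abs fun y => ?_
  rw [abs_mul]
  exact mul_le_of_le_one_left (abs_nonneg _) (U.abs_le_one x y)

theorem measurable_op (hU : Measurable fun p : I × I => U.toFun p.1 p.2) {f : I → ℝ}
    (hf : Measurable f) : Measurable (U.op f) := by
  have : StronglyMeasurable fun p : I × I => U.toFun p.1 p.2 * f p.2 :=
    (hU.mul (hf.comp measurable_snd)).stronglyMeasurable
  exact (this.integral_prod_right (ν := volume)).measurable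

theorem integral_abs_le_norm (u : Lp ℝ 2 (volume : Measure I)) : ∫ y, |u y| ≤ ‖u‖ := by
  have h1 : eLpNorm u 1 (volume : Measure I) ≤ eLpNorm u 2 volume :=
    eLpNorm_le_eLpNorm_of_exponent_le (by norm_num) (Lp.aestronglyMeasurable u)
  have h2 := ENNReal.toReal_mono (Lp.eLpNorm_ne_top u) h1
  rw [← Lp.norm_def] at h2
  refine le_trans (le_of_eq ?_) h2
  rw [eLpNorm_one_eq_lintegral_enorm]
  rw [integral_eq_lintegral_of_nonneg_ae (Eventually.of_forall fun _ => abs_nonneg _)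
    (Lp.aestronglyMeasurable u).norm]
  congr 1
  refine lintegral_congr fun y => ?_
  rw [← Real.norm_eq_abs, ofReal_norm]

theorem integrable_coeFn (u : Lp ℝ 2 (volume : Measure I)) : Integrable u :=
  (Lp.memLp u).integrable (by norm_num)

theorem memLp_op (hU : Measurable fun p : I × I => U.toFun p.1 p.2)
    (u : Lp ℝ 2 (volume : Measure I)) : MemLp (U.op u) 2 volume := by
  refine MemLp.of_bound
    (U.measurable_op hU (Lp.stronglyMeasurable u).measurable).aestronglyMeasurable (∫ y, |u y|)
    (Eventually.of_forall fun x => ?_)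
  simpa using U.abs_op_le hU (integrable_coeFn u) x

theorem op_add_of_integrable (hU : Measurable fun p : I × I => U.toFun p.1 p.2) {f g : I → ℝ}
    (hf : Integrable f) (hg : Integrable g) : U.op (f + g) = U.op f + U.op g := by
  funext x
  simp only [op, Pi.add_apply, mul_add]
  exact integral_add (U.integrable_mul hU hf x) (U.integrable_mul hU hg x)

theorem op_smul (c : ℝ) (f : I → ℝ) : U.op (c • f) = c • U.op f := by
  funext x
  simp only [op, Pi.smul_apply, smul_eq_mul]
  rw [← integral_const_mul]
  exact integral_congr_ae (Eventually.of_forall fun y => by ring)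

/-- The operator `A_U` as a bounded operator on `L²[0,1]`. -/
noncomputable def opL2 (hU : Measurable fun p : I × I => U.toFun p.1 p.2) :
    Lp ℝ 2 (volume : Measure I) →L[ℝ] Lp ℝ 2 (volume : Measure I) :=
  LinearMap.mkContinuous
    { toFun := fun u => (U.memLp_op hU u).toLp
      map_add' := fun u v => by
        rw [← MemLp.toLp_add]
        congr 1
        rw [U.op_congr (Lp.coeFn_add u v),
          U.op_add_of_integrable hU (integrable_coeFn u) (integrable_coeFn v)]
      map_smul' := fun c u => by
        simp only [RingHom.id_apply]
        rw [← MemLp.toLp_const_smul]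
        congr 1
        rw [U.op_congr (Lp.coeFn_smul c u), op_smul] } 1 (fun u => by
      refine (Lp.norm_le_of_ae_bound (C := ‖u‖) (norm_nonneg _) ?_).trans ?_
      · have hm := U.memLp_op hU u
        refine hm.coeFn_toLp.mono fun x hx => ?_
        change ‖(MemLp.toLp _ hm : I → ℝ) x‖ ≤ ‖u‖
        rw [hx]
        exact (U.abs_op_le hU (integrable_coeFn u) x).trans (integral_abs_le_norm u)
      · have h1 : measureUnivNNReal (volume : Measure I) = 1 := by simp [measureUnivNNReal]
        simp [h1])

theorem coeFn_opL2 (hU : Measurable fun p : I × I => U.toFun p.1 p.2)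
    (u : Lp ℝ 2 (volume : Measure I)) : U.opL2 hU u =ᵐ[volume] U.op u :=
  MemLp.coeFn_toLp (U.memLp_op hU u)

theorem inner_opL2 (hU : Measurable fun p : I × I => U.toFun p.1 p.2)
    (u v : Lp ℝ 2 (volume : Measure I)) :
    inner ℝ (U.opL2 hU u) v = ∫ x, U.op u x * v x := by
  rw [L2.inner_def]
  refine integral_congr_ae ((U.coeFn_opL2 hU u).mono fun x hx => ?_)
  simp [hx, mul_comm]

theorem integral_op_mul_comm (hU : Measurable fun p : I × I => U.toFun p.1 p.2) {f g : I → ℝ}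
    (hf : Integrable f) (hg : Integrable g) :
    ∫ x, U.op f x * g x = ∫ x, f x * U.op g x := by
  have hint : Integrable (fun p : I × I => U.toFun p.1 p.2 * (g p.1 * f p.2))
      (volume.prod volume) :=
    (hg.mul_prod hf).bdd_mul (c := 1) hU.aestronglyMeasurable
      (Eventually.of_forall fun p => by simpa using U.abs_le_one p.1 p.2)
  calc ∫ x, U.op f x * g x = ∫ x, ∫ y, U.toFun x y * (g x * f y) := by
        refine integral_congr_ae (Eventually.of_forall fun x => ?_)
        simp only [op]
        rw [← integral_mul_const]
        exact integral_congr_ae (Eventually.of_forall fun y => by ring)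
    _ = ∫ y, ∫ x, U.toFun x y * (g x * f y) := integral_integral_swap hint
    _ = ∫ x, f x * U.op g x := by
        refine integral_congr_ae (Eventually.of_forall fun x => ?_)
        simp only [op]
        rw [← integral_const_mul]
        refine integral_congr_ae (Eventually.of_forall fun y => ?_)
        simp only [U.symm' y x]; ring

theorem isSelfAdjoint_opL2 (hU : Measurable fun p : I × I => U.toFun p.1 p.2) :
    IsSelfAdjoint (U.opL2 hU) := by
  rw [ContinuousLinearMap.isSelfAdjoint_iff_isSymmetric]
  intro u v
  change inner ℝ (U.opL2 hU u) v = inner ℝ u (U.opL2 hU v)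
  rw [real_inner_comm (U.opL2 hU v) u, inner_opL2, inner_opL2,
    U.integral_op_mul_comm hU (integrable_coeFn u) (integrable_coeFn v)]
  exact integral_congr_ae (Eventually.of_forall fun x => mul_comm _ _)

/-- `A_U` is completely continuous: weak convergence gives pointwise convergence of the images, which
are uniformly bounded, so dominated convergence applies. -/
theorem tendsto_opL2 (hU : Measurable fun p : I × I => U.toFun p.1 p.2)
    (u : ℕ → Lp ℝ 2 (volume : Measure I)) (x : Lp ℝ 2 (volume : Measure I))
    (hu : ∀ n, ‖u n‖ ≤ 1)
    (hw : ∀ v, Tendsto (fun n => inner ℝ (u n) v) atTop (𝓝 (inner ℝ x v))) :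
    Tendsto (fun n => U.opL2 hU (u n)) atTop (𝓝 (U.opL2 hU x)) := by
  have hpt : ∀ t, Tendsto (fun n => U.op (u n) t) atTop (𝓝 (U.op x t)) := by
    intro t
    have hm : MemLp (U.toFun t) 2 (volume : Measure I) :=
      MemLp.of_bound (U.measurable_right hU t).aestronglyMeasurable 1
        (Eventually.of_forall fun y => by simpa using U.abs_le_one t y)
    have key : ∀ w : Lp ℝ 2 (volume : Measure I), inner ℝ w hm.toLp = U.op w t := by
      intro w
      rw [L2.inner_def]
      refine integral_congr_ae (hm.coeFn_toLp.mono fun y hy => ?_)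
      simp [hy]
    have := hw hm.toLp
    simp only [key] at this
    exact this
  have hb : ∀ n t, |U.op (u n) t| ≤ 1 := fun n t =>
    (U.abs_op_le hU (integrable_coeFn _) t).trans ((integral_abs_le_norm _).trans (hu n))
  rw [tendsto_iff_norm_sub_tendsto_zero]
  have hsq : Tendsto (fun n => ‖U.opL2 hU (u n) - U.opL2 hU x‖ ^ 2) atTop (𝓝 0) := by
    have heq : ∀ n, ‖U.opL2 hU (u n) - U.opL2 hU x‖ ^ 2
        = ∫ t, (U.op (u n) t - U.op x t) ^ 2 := by
      intro n
      rw [← real_inner_self_eq_norm_sq, L2.inner_def]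
      refine integral_congr_ae ?_
      filter_upwards [Lp.coeFn_sub (U.opL2 hU (u n)) (U.opL2 hU x), U.coeFn_opL2 hU (u n),
        U.coeFn_opL2 hU x] with t h1 h2 h3
      simp only [h1, Pi.sub_apply, h2, h3]
      simp [sq]
    simp only [heq]
    have h0 : (0 : ℝ) = ∫ _ : I, (0 : ℝ) := by simp
    rw [h0]
    refine tendsto_integral_of_dominated_convergence (fun _ => (1 + ∫ y, |x y|) ^ 2) ?_ ?_ ?_ ?_
    · intro n
      exact (((U.measurable_op hU (Lp.stronglyMeasurable (u n)).measurable).sub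
        (U.measurable_op hU (Lp.stronglyMeasurable x).measurable)).pow_const 2).aestronglyMeasurable
    · exact integrable_const _
    · intro n
      refine Eventually.of_forall fun t => ?_
      rw [Real.norm_eq_abs, abs_pow]
      gcongr
      exact (abs_sub _ _).trans (add_le_add (hb n t) (U.abs_op_le hU (integrable_coeFn x) t))
    · refine Eventually.of_forall fun t => ?_
      have := ((hpt t).sub_const (U.op x t)).pow 2
      simpa using this
  have := hsq.sqrt
  simpa using this

end Graphon

/-! ### Bounded trial functions and the variational principle -/

/-- Bounded Borel functions on the unit interval. All trial functions below are of this kind, so that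
integrability is never an issue. -/
def IsBdd (u : I → ℝ) : Prop := Measurable u ∧ ∃ C, ∀ x, |u x| ≤ C

namespace IsBdd

variable {u v : I → ℝ}

theorem const (c : ℝ) : IsBdd fun _ => c := ⟨measurable_const, |c|, fun _ => le_rfl⟩

theorem add (hu : IsBdd u) (hv : IsBdd v) : IsBdd (u + v) := by
  obtain ⟨hu, C, hC⟩ := hu
  obtain ⟨hv, D, hD⟩ := hv
  exact ⟨hu.add hv, C + D, fun x => (abs_add_le _ _).trans (add_le_add (hC x) (hD x))⟩

theorem mul (hu : IsBdd u) (hv : IsBdd v) : IsBdd (u * v) := by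
  obtain ⟨hu, C, hC⟩ := hu
  obtain ⟨hv, D, hD⟩ := hv
  refine ⟨hu.mul hv, C * D, fun x => ?_⟩
  rw [Pi.mul_apply, abs_mul]
  exact mul_le_mul (hC x) (hD x) (abs_nonneg _) ((abs_nonneg _).trans (hC x))

theorem smul (c : ℝ) (hu : IsBdd u) : IsBdd (c • u) := (const c).mul hu

theorem neg (hu : IsBdd u) : IsBdd (-u) := by
  have := hu.smul (-1)
  simpa using this

theorem sub (hu : IsBdd u) (hv : IsBdd v) : IsBdd (u - v) := by
  rw [sub_eq_add_neg]; exact hu.add hv.neg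

theorem abs (hu : IsBdd u) : IsBdd |u| :=
  ⟨hu.1.abs, hu.2.imp fun C hC x => by simpa using hC x⟩

theorem indicator (hu : IsBdd u) {S : Set I} (hS : MeasurableSet S) : IsBdd (S.indicator u) := by
  obtain ⟨hu, C, hC⟩ := hu
  refine ⟨hu.indicator hS, C, fun x => ?_⟩
  by_cases hx : x ∈ S
  · simpa [hx] using hC x
  · simpa [hx] using (abs_nonneg _).trans (hC x)

theorem integrable (hu : IsBdd u) : Integrable u := by
  obtain ⟨hu, C, hC⟩ := hu
  exact (integrable_const C).mono' hu.aestronglyMeasurable (Eventually.of_forall hC)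

theorem integrable_mul (hu : IsBdd u) (hv : IsBdd v) : Integrable fun x => u x * v x :=
  (hu.mul hv).integrable

theorem memLp (hu : IsBdd u) : MemLp u 2 volume := by
  obtain ⟨hu, C, hC⟩ := hu
  exact MemLp.of_bound hu.aestronglyMeasurable C (Eventually.of_forall hC)

theorem op (U : Graphon) (hU : Measurable fun p : I × I => U.toFun p.1 p.2) (hu : IsBdd u) :
    IsBdd (U.op u) :=
  ⟨U.measurable_op hU hu.1, _, fun x => U.abs_op_le hU hu.integrable x⟩

end IsBdd

/-- The inner product `∫ u v` of `L²[0,1]`, on functions. -/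
noncomputable def ip (u v : I → ℝ) : ℝ := ∫ x, u x * v x

theorem ip_comm (u v : I → ℝ) : ip u v = ip v u := by
  simp only [ip, mul_comm]

theorem ip_add_left {u v w : I → ℝ} (hu : IsBdd u) (hv : IsBdd v) (hw : IsBdd w) :
    ip (u + v) w = ip u w + ip v w := by
  simp only [ip, Pi.add_apply, add_mul]
  exact integral_add (hu.mul hw).integrable (hv.mul hw).integrable

theorem ip_smul_left (c : ℝ) (u v : I → ℝ) : ip (c • u) v = c * ip u v := by
  simp only [ip, Pi.smul_apply, smul_eq_mul, mul_assoc]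
  exact integral_const_mul _ _

theorem ip_add_right {u v w : I → ℝ} (hu : IsBdd u) (hv : IsBdd v) (hw : IsBdd w) :
    ip w (u + v) = ip w u + ip w v := by
  rw [ip_comm, ip_add_left hu hv hw, ip_comm u, ip_comm v]

theorem ip_smul_right (c : ℝ) (u v : I → ℝ) : ip u (c • v) = c * ip u v := by
  rw [ip_comm, ip_smul_left, ip_comm]

theorem ip_neg_left (u v : I → ℝ) : ip (-u) v = -ip u v := by
  have := ip_smul_left (-1) u v
  simpa using this

theorem ip_sub_left {u v w : I → ℝ} (hu : IsBdd u) (hv : IsBdd v) (hw : IsBdd w) :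
    ip (u - v) w = ip u w - ip v w := by
  rw [sub_eq_add_neg, ip_add_left hu hv.neg hw, ip_neg_left, sub_eq_add_neg]

theorem ip_self_nonneg (u : I → ℝ) : 0 ≤ ip u u :=
  integral_nonneg fun x => mul_self_nonneg (u x)

theorem ae_eq_zero_of_ip_self {u : I → ℝ} (hu : MemLp u 2 volume) (h : ip u u = 0) :
    u =ᵐ[volume] 0 := by
  have hi : Integrable fun x => u x * u x := by
    simpa [sq] using hu.integrable_sq
  have := (integral_eq_zero_iff_of_nonneg (fun x => mul_self_nonneg (u x)) hi).1 h
  filter_upwards [this] with x hx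
  simpa using hx

theorem ip_self_pos {u : I → ℝ} (hu : MemLp u 2 volume) (h : ¬ u =ᵐ[volume] 0) : 0 < ip u u :=
  lt_of_le_of_ne (ip_self_nonneg u) fun h0 => h (ae_eq_zero_of_ip_self hu h0.symm)

theorem ip_congr {u u' v v' : I → ℝ} (h : u =ᵐ[volume] u') (h' : v =ᵐ[volume] v') :
    ip u v = ip u' v' := by
  refine integral_congr_ae ?_
  filter_upwards [h, h'] with x hx hx'
  rw [hx, hx']

namespace Graphon

/-- The symmetric bilinear form `⟨A_U u, v⟩` of a graphon `U`. -/
noncomputable def form (U : Graphon) (u v : I → ℝ) : ℝ := ip (U.op u) v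

variable (U : Graphon)

theorem op_add (hU : Measurable fun p : I × I => U.toFun p.1 p.2) {u v : I → ℝ}
    (hu : IsBdd u) (hv : IsBdd v) : U.op (u + v) = U.op u + U.op v :=
  U.op_add_of_integrable hU hu.integrable hv.integrable

theorem form_comm (hU : Measurable fun p : I × I => U.toFun p.1 p.2) {u v : I → ℝ}
    (hu : IsBdd u) (hv : IsBdd v) : U.form u v = U.form v u := by
  rw [form, form, ip_comm (U.op v)]
  exact U.integral_op_mul_comm hU hu.integrable hv.integrable

theorem form_add_left (hU : Measurable fun p : I × I => U.toFun p.1 p.2) {u v w : I → ℝ}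
    (hu : IsBdd u) (hv : IsBdd v) (hw : IsBdd w) :
    U.form (u + v) w = U.form u w + U.form v w := by
  rw [form, U.op_add hU hu hv, ip_add_left (hu.op U hU) (hv.op U hU) hw]; rfl

theorem form_add_right (hU : Measurable fun p : I × I => U.toFun p.1 p.2) {u v w : I → ℝ}
    (hu : IsBdd u) (hv : IsBdd v) (hw : IsBdd w) :
    U.form w (u + v) = U.form w u + U.form w v :=
  ip_add_right hu hv (hw.op U hU)

theorem form_smul_left (c : ℝ) (u v : I → ℝ) : U.form (c • u) v = c * U.form u v := by
  rw [form, op_smul, ip_smul_left]; rfl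

theorem form_smul_right (c : ℝ) (u v : I → ℝ) : U.form u (c • v) = c * U.form u v :=
  ip_smul_right c _ _

theorem form_congr {u u' : I → ℝ} (h : u =ᵐ[volume] u') : U.form u u = U.form u' u' := by
  rw [form, form, U.op_congr h]
  exact ip_congr (ae_eq_refl _) h

theorem form_eigenfunction {c : ℝ} {f : I → ℝ} (hf : U.IsEigenfunction c f) :
    U.form f f = c * ip f f := by
  rw [← ip_smul_left]
  exact ip_congr (hf.2.2) (ae_eq_refl _)

theorem abs_le_one_of_mem_eigenvalues (hU : Measurable fun p : I × I => U.toFun p.1 p.2) {c : ℝ}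
    (hc : c ∈ U.eigenvalues) : |c| ≤ 1 := by
  obtain ⟨f, hf, hf0, hfe⟩ := hc
  have hfi : Integrable f := hf.integrable (by norm_num)
  have hpos : 0 < ∫ y, |f y| := by
    refine lt_of_le_of_ne (integral_nonneg fun _ => abs_nonneg _) fun h => hf0 ?_
    have := (integral_eq_zero_iff_of_nonneg (fun x => abs_nonneg (f x)) hfi.abs).1 h.symm
    filter_upwards [this] with x hx
    simpa using hx
  have h1 : |c| * ∫ y, |f y| ≤ ∫ y, |f y| := by
    rw [← integral_const_mul]
    have : ∫ x, |c| * |f x| ≤ ∫ _ : I, (∫ y, |f y|) := by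
      refine integral_mono_ae (hfi.abs.const_mul _) (integrable_const _) ?_
      filter_upwards [hfe] with x hx
      rw [← abs_mul, ← hx]
      exact U.abs_op_le hU hfi x
    simpa using this
  exact le_of_mul_le_mul_right (by linarith) hpos

theorem norm_sq_eq_ip (u : Lp ℝ 2 (volume : Measure I)) : ‖u‖ ^ 2 = ip u u := by
  rw [← real_inner_self_eq_norm_sq, L2.inner_def]
  rfl

theorem isEigenfunction_of_opL2 (hU : Measurable fun p : I × I => U.toFun p.1 p.2) {c : ℝ}
    {x : Lp ℝ 2 (volume : Measure I)} (hx : x ≠ 0) (h : U.opL2 hU x = c • x) :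
    U.IsEigenfunction c x := by
  refine ⟨Lp.memLp x, fun h0 => hx ((Lp.eq_zero_iff_ae_eq_zero).2 h0), ?_⟩
  filter_upwards [U.coeFn_opL2 hU x, Lp.coeFn_smul c x] with t h1 h2
  rw [← h1, h, h2]; rfl

theorem form_toLp (hU : Measurable fun p : I × I => U.toFun p.1 p.2) {v : I → ℝ}
    (hv : MemLp v 2 volume) : inner ℝ (U.opL2 hU hv.toLp) hv.toLp = U.form v v := by
  rw [inner_opL2]
  exact (U.form_congr hv.coeFn_toLp)

theorem norm_sq_toLp {v : I → ℝ} (hv : MemLp v 2 (volume : Measure I)) :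
    ‖hv.toLp‖ ^ 2 = ip v v := by
  rw [norm_sq_eq_ip]
  exact ip_congr hv.coeFn_toLp hv.coeFn_toLp

/-- If the form of `U` is positive somewhere, then `μ(U)` is a positive eigenvalue, given by the
variational principle. -/
theorem maxEigenvalue_of_form_pos (hU : Measurable fun p : I × I => U.toFun p.1 p.2) {w : I → ℝ}
    (hw : MemLp w 2 volume) (hpos : 0 < U.form w w) :
    0 < U.maxEigenvalue ∧ U.maxEigenvalue ∈ U.eigenvalues ∧
      ∀ v, MemLp v 2 volume → U.form v v ≤ U.maxEigenvalue * ip v v := by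
  have : Fact ((2 : ENNReal) ≠ ⊤) := ⟨by norm_num⟩
  obtain ⟨c, hc, ⟨x, hx0, hx⟩, hle⟩ := exists_eigenvector_of_inner_pos (U.opL2 hU)
    (U.isSelfAdjoint_opL2 hU) (U.tendsto_opL2 hU) hw.toLp (by rwa [form_toLp])
  have hle' : ∀ v, MemLp v 2 volume → U.form v v ≤ c * ip v v := fun v hv => by
    have := hle hv.toLp
    rwa [form_toLp, norm_sq_toLp] at this
  have hgr : IsGreatest U.eigenvalues c := by
    refine ⟨⟨x, U.isEigenfunction_of_opL2 hU hx0 hx⟩, ?_⟩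
    rintro d ⟨f, hf⟩
    have h1 := hle' f hf.1
    rw [U.form_eigenfunction hf] at h1
    exact le_of_mul_le_mul_right h1 (ip_self_pos hf.1 hf.2.1)
  rw [maxEigenvalue, hgr.csSup_eq]
  exact ⟨hc, hgr.1, hle'⟩

/-- If the form of `U` is negative somewhere, then `ν(U)` is a negative eigenvalue, given by the
variational principle. -/
theorem minEigenvalue_of_form_neg (hU : Measurable fun p : I × I => U.toFun p.1 p.2) {w : I → ℝ}
    (hw : MemLp w 2 volume) (hneg : U.form w w < 0) :
    U.minEigenvalue < 0 ∧ U.minEigenvalue ∈ U.eigenvalues ∧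
      ∀ v, MemLp v 2 volume → U.minEigenvalue * ip v v ≤ U.form v v := by
  have : Fact ((2 : ENNReal) ≠ ⊤) := ⟨by norm_num⟩
  obtain ⟨c, hc, ⟨x, hx0, hx⟩, hle⟩ := exists_eigenvector_of_inner_pos (-U.opL2 hU)
    (U.isSelfAdjoint_opL2 hU).neg
    (fun u x hu hw => by simpa using (U.tendsto_opL2 hU u x hu hw).neg) hw.toLp
    (by simp only [neg_apply, inner_neg_left]; rw [form_toLp]; linarith)
  have hle' : ∀ v, MemLp v 2 volume → -c * ip v v ≤ U.form v v := fun v hv => by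
    have := hle hv.toLp
    simp only [neg_apply, inner_neg_left] at this
    rw [form_toLp, norm_sq_toLp] at this
    linarith
  have hx' : U.opL2 hU x = (-c) • x := by
    simp only [neg_apply] at hx
    rw [neg_smul, ← hx, neg_neg]
  have hgr : IsLeast U.eigenvalues (-c) := by
    refine ⟨⟨x, U.isEigenfunction_of_opL2 hU hx0 hx'⟩, ?_⟩
    rintro d ⟨f, hf⟩
    have h1 := hle' f hf.1
    rw [U.form_eigenfunction hf] at h1
    exact le_of_mul_le_mul_right h1 (ip_self_pos hf.1 hf.2.1)
  rw [minEigenvalue, hgr.csInf_eq]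
  exact ⟨by linarith, hgr.1, hle'⟩

/-- The Rayleigh quotients of two trial functions bound the spread from below. -/
theorem sub_le_spread (hU : Measurable fun p : I × I => U.toFun p.1 p.2) {u v : I → ℝ}
    (hu : MemLp u 2 volume) (hv : MemLp v 2 volume) (hpos : 0 < U.form u u)
    (hneg : U.form v v < 0) :
    U.form u u / ip u u - U.form v v / ip v v ≤ U.spread := by
  obtain ⟨h1, -, h2⟩ := U.maxEigenvalue_of_form_pos hU hu hpos
  obtain ⟨h3, -, h4⟩ := U.minEigenvalue_of_form_neg hU hv hneg
  have hu0 : 0 < ip u u := by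
    have := h2 u hu
    by_contra h
    have h0 := le_antisymm (not_lt.1 h) (ip_self_nonneg u)
    rw [h0] at this; linarith
  have hv0 : 0 < ip v v := by
    have := h4 v hv
    by_contra h
    have h0 := le_antisymm (not_lt.1 h) (ip_self_nonneg v)
    rw [h0] at this; linarith
  have h5 := (div_le_iff₀ hu0).2 (h2 u hu)
  have h6 := (le_div_iff₀ hv0).2 (h4 v hv)
  rw [spread]; linarith

/-- A function that attains an extremal value `c` of the Rayleigh quotient is an eigenfunction. The
sign `s` covers the maximum and the minimum at the same time. -/
theorem ae_op_eq_of_form_eq (hU : Measurable fun p : I × I => U.toFun p.1 p.2) {s c : ℝ}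
    (hs : s ≠ 0) {u : I → ℝ} (hu : IsBdd u)
    (hle : ∀ v, IsBdd v → 0 ≤ s * (c * ip v v - U.form v v)) (heq : U.form u u = c * ip u u) :
    U.op u =ᵐ[volume] c • u := by
  have hou := hu.op U hU
  set v : I → ℝ := c • u - U.op u with hv
  have hvb : IsBdd v := (hu.smul c).sub hou
  have hlin : c * ip u v - U.form u v = ip v v := by
    rw [form, ← ip_smul_left, ← ip_sub_left (hu.smul c) hou hvb]
  have hexp : ∀ t : ℝ, 0 ≤ (s * (c * ip v v - U.form v v)) * (t * t)
      + (2 * s * ip v v) * t + 0 := by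
    intro t
    have h1 := hle (u + t • v) (hu.add (hvb.smul t))
    have h2 := hvb.smul t
    rw [ip_add_left hu h2 (hu.add h2), ip_add_right hu h2 hu, ip_add_right hu h2 h2,
      U.form_add_left hU hu h2 (hu.add h2), U.form_add_right hU hu h2 hu,
      U.form_add_right hU hu h2 h2, U.form_smul_left, U.form_smul_left, U.form_smul_right,
      U.form_smul_right, ip_smul_left, ip_smul_left, ip_smul_right, ip_smul_right, heq,
      U.form_comm hU hvb hu, ip_comm v u] at h1
    calc 0 ≤ _ := h1
      _ = (s * (c * ip v v - U.form v v)) * (t * t) + (2 * s * (c * ip u v - U.form u v)) * t + 0 := by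
        ring
      _ = _ := by rw [hlin]
  have hdisc := discrim_le_zero hexp
  have h0 : ip v v = 0 := by
    have : (2 * s * ip v v) ^ 2 ≤ 0 := by simpa [discrim] using hdisc
    have h2 : 2 * s * ip v v = 0 := by nlinarith [sq_nonneg (2 * s * ip v v)]
    simpa [hs] using h2
  filter_upwards [ae_eq_zero_of_ip_self hvb.memLp h0] with x hx
  simp only [hv, Pi.sub_apply, Pi.zero_apply] at hx
  linarith

/-- `f` is a bounded Borel eigenfunction of norm one, for which the eigenvalue equation holds at every
point. -/
structure UnitEigen (c : ℝ) (f : I → ℝ) : Prop where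
  bdd : IsBdd f
  op_eq : ∀ x, U.op f x = c * f x
  norm : ip f f = 1

/-- Up to a null set and a factor, every eigenfunction for `c ≠ 0` is a `UnitEigen`: replace `f` by
`c⁻¹ A_U f`. -/
theorem exists_unitEigen (hU : Measurable fun p : I × I => U.toFun p.1 p.2) {c : ℝ} (hc : c ≠ 0)
    {f : I → ℝ} (hf : U.IsEigenfunction c f) :
    ∃ (a : ℝ) (f' : I → ℝ), 0 < a ∧ U.UnitEigen c f' ∧ f =ᵐ[volume] a • f' := by
  obtain ⟨hL, h0, he⟩ := hf
  set f₁ := hL.1.mk f with hf₁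
  have h1 : f =ᵐ[volume] f₁ := hL.1.ae_eq_mk
  have hop : U.op f = U.op f₁ := U.op_congr h1
  have hi : Integrable f₁ := (hL.integrable (by norm_num)).congr h1
  have hb : IsBdd (U.op f) := by
    rw [hop]
    exact ⟨U.measurable_op hU (hL.1.stronglyMeasurable_mk).measurable, _,
      fun x => U.abs_op_le hU hi x⟩
  set f₂ : I → ℝ := c⁻¹ • U.op f with hf₂
  have h2 : f =ᵐ[volume] f₂ := by
    filter_upwards [he] with x hx
    simp [hf₂, hx, hc]
  have hb2 : IsBdd f₂ := hb.smul _
  have hop2 : ∀ x, U.op f₂ x = c * f₂ x := by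
    intro x
    rw [← U.op_congr h2]
    simp [hf₂, hc]
  have hpos : 0 < ip f₂ f₂ := ip_self_pos hb2.memLp fun h => h0 (h2.trans h)
  have hs : 0 < Real.sqrt (ip f₂ f₂) := Real.sqrt_pos.2 hpos
  clear_value f₂
  refine ⟨Real.sqrt (ip f₂ f₂), (Real.sqrt (ip f₂ f₂))⁻¹ • f₂, hs, ⟨hb2.smul _, ?_, ?_⟩, ?_⟩
  · intro x
    rw [op_smul]
    simp only [Pi.smul_apply, smul_eq_mul, hop2]; ring
  · rw [ip_smul_left, ip_smul_right, ← mul_assoc, ← mul_inv, Real.mul_self_sqrt hpos.le,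
      inv_mul_cancel₀ hpos.ne']
  · rw [smul_smul, mul_inv_cancel₀ hs.ne', one_smul]
    exact h2

end Graphon

/-! ### Maximizers of the spread: changing the values of the kernel -/

namespace Graphon

/-- The midpoint of the unit interval. -/
noncomputable def halfPoint : I := ⟨1 / 2, by constructor <;> norm_num⟩

/-- The complete graphon with the square `(1/2,1]²` removed. -/
noncomputable def splitGraphon : Graphon where
  toFun x y := 1 - (Set.Ioi halfPoint).indicator 1 x * (Set.Ioi halfPoint).indicator 1 y
  aemeasurable' := by
    have h : Measurable ((Set.Ioi halfPoint).indicator (1 : I → ℝ)) :=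
      measurable_one.indicator measurableSet_Ioi
    exact (measurable_const.sub ((h.comp measurable_fst).mul (h.comp measurable_snd))).aemeasurable
  symm' x y := by ring
  mem_Icc' x y := by
    by_cases hx : x ∈ Set.Ioi halfPoint <;> by_cases hy : y ∈ Set.Ioi halfPoint <;>
      simp [hx, hy]

/-- The trial functions are `1`, and the function with the values `-1/2` and `1` on the two halves of
the interval; their Rayleigh quotients are `3/4` and `-3/10`. -/
theorem one_lt_spread_splitGraphon : 1 < splitGraphon.spread := by
  set χ : I → ℝ := (Set.Ioi halfPoint).indicator 1 with hχ
  have hχb : IsBdd χ := (IsBdd.const 1).indicator measurableSet_Ioi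
  have h1b : IsBdd (1 : I → ℝ) := IsBdd.const 1
  have hm : Measurable fun p : I × I => splitGraphon.toFun p.1 p.2 :=
    measurable_const.sub ((hχb.1.comp measurable_fst).mul (hχb.1.comp measurable_snd))
  have i11 : ip (1 : I → ℝ) 1 = 1 := by simp [ip]
  have hint : ∫ x, χ x = 1 / 2 := by
    rw [hχ, integral_indicator_one measurableSet_Ioi, measureReal_def, unitInterval.volume_Ioi]
    simp only [halfPoint]
    rw [ENNReal.toReal_ofReal] <;> norm_num
  have i1χ : ip (1 : I → ℝ) χ = 1 / 2 := by simpa [ip] using hint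
  have iχ1 : ip χ (1 : I → ℝ) = 1 / 2 := by rw [ip_comm, i1χ]
  have iχχ : ip χ χ = 1 / 2 := by
    rw [← hint]
    refine integral_congr_ae (Eventually.of_forall fun x => ?_)
    by_cases hx : x ∈ Set.Ioi halfPoint <;> simp [hχ, hx]
  have hop : ∀ u, IsBdd u → splitGraphon.op u = ip 1 u • (1 : I → ℝ) - ip χ u • χ := by
    intro u hu
    funext x
    have : splitGraphon.op u x = ∫ y, ((1 * u y) - χ x * (χ y * u y)) := by
      refine integral_congr_ae (Eventually.of_forall fun y => ?_)
      change (1 - χ x * χ y) * u y = _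
      ring
    rw [this, integral_sub (hu.integrable.const_mul 1)
      ((hχb.integrable_mul hu).const_mul (χ x)), integral_const_mul (χ x)]
    simp [ip]; ring
  have hform : ∀ u, IsBdd u → splitGraphon.form u u = ip 1 u * ip 1 u - ip χ u * ip χ u := by
    intro u hu
    rw [form, hop u hu, ip_sub_left (h1b.smul _) (hχb.smul _) hu, ip_smul_left, ip_smul_left]
  set v : I → ℝ := (-1 / 2 : ℝ) • 1 + (3 / 2 : ℝ) • χ with hv
  have hvb : IsBdd v := (h1b.smul _).add (hχb.smul _)
  have i1v : ip 1 v = 1 / 4 := by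
    rw [hv, ip_add_right (h1b.smul _) (hχb.smul _) h1b, ip_smul_right, ip_smul_right, i11, i1χ]
    norm_num
  have iχv : ip χ v = 1 / 2 := by
    rw [hv, ip_add_right (h1b.smul _) (hχb.smul _) hχb, ip_smul_right, ip_smul_right, iχχ, iχ1]
    norm_num
  have ivv : ip v v = 5 / 8 := by
    nth_rw 1 [hv]
    rw [ip_add_left (h1b.smul _) (hχb.smul _) hvb, ip_smul_left, ip_smul_left, i1v, iχv]
    norm_num
  have f1 : splitGraphon.form 1 1 = 3 / 4 := by rw [hform 1 h1b, i11, iχ1]; norm_num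
  have fv : splitGraphon.form v v = -3 / 16 := by rw [hform v hvb, i1v, iχv]; norm_num
  have := splitGraphon.sub_le_spread hm h1b.memLp hvb.memLp (by rw [f1]; norm_num)
    (by rw [fv]; norm_num)
  rw [f1, fv, i11, ivv] at this
  norm_num at this
  linarith

/-- A maximizer of the spread, with a Borel measurable kernel. -/
structure IsExtremal (W : Graphon) : Prop where
  measurable : Measurable fun p : I × I => W.toFun p.1 p.2
  spread_le : ∀ U : Graphon, U.spread ≤ W.spread

namespace IsExtremal

variable {W : Graphon} (hW : W.IsExtremal)
include hW

theorem one_lt_spread : 1 < W.spread :=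
  one_lt_spread_splitGraphon.trans_le (hW.spread_le _)

theorem maxEigenvalue_facts : 0 < W.maxEigenvalue ∧ W.maxEigenvalue ∈ W.eigenvalues ∧
    ∀ v, MemLp v 2 volume → W.form v v ≤ W.maxEigenvalue * ip v v := by
  have h1 := hW.one_lt_spread
  have hle : ∀ c ∈ W.eigenvalues, |c| ≤ 1 := fun c hc =>
    W.abs_le_one_of_mem_eigenvalues hW.measurable hc
  have hne : W.eigenvalues.Nonempty := by
    by_contra h
    rw [Set.not_nonempty_iff_eq_empty] at h
    rw [spread, maxEigenvalue, minEigenvalue, h] at h1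
    simp at h1; linarith
  have hinf : -1 ≤ W.minEigenvalue := le_csInf hne fun c hc => (abs_le.1 (hle c hc)).1
  have hpos : 0 < sSup W.eigenvalues := by
    have : W.spread = sSup W.eigenvalues - W.minEigenvalue := rfl
    linarith
  obtain ⟨c, ⟨f, hf⟩, hc⟩ := exists_lt_of_lt_csSup hne hpos
  refine W.maxEigenvalue_of_form_pos hW.measurable hf.1 ?_
  rw [W.form_eigenfunction hf]
  exact mul_pos hc (ip_self_pos hf.1 hf.2.1)

theorem minEigenvalue_facts : W.minEigenvalue < 0 ∧ W.minEigenvalue ∈ W.eigenvalues ∧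
    ∀ v, MemLp v 2 volume → W.minEigenvalue * ip v v ≤ W.form v v := by
  have h1 := hW.one_lt_spread
  have hle : ∀ c ∈ W.eigenvalues, |c| ≤ 1 := fun c hc =>
    W.abs_le_one_of_mem_eigenvalues hW.measurable hc
  have hne : W.eigenvalues.Nonempty := ⟨_, hW.maxEigenvalue_facts.2.1⟩
  have hsup : W.maxEigenvalue ≤ 1 := csSup_le hne fun c hc => (abs_le.1 (hle c hc)).2
  have hneg : sInf W.eigenvalues < 0 := by
    have : W.spread = W.maxEigenvalue - sInf W.eigenvalues := rfl
    linarith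
  obtain ⟨c, ⟨f, hf⟩, hc⟩ := exists_lt_of_csInf_lt hne hneg
  refine W.minEigenvalue_of_form_neg hW.measurable hf.1 ?_
  rw [W.form_eigenfunction hf]
  exact mul_neg_of_neg_of_pos hc (ip_self_pos hf.1 hf.2.1)

theorem maxEigenvalue_pos : 0 < W.maxEigenvalue := hW.maxEigenvalue_facts.1

theorem minEigenvalue_neg : W.minEigenvalue < 0 := hW.minEigenvalue_facts.1

theorem maxEigenvalue_le_one : W.maxEigenvalue ≤ 1 :=
  (abs_le.1 (W.abs_le_one_of_mem_eigenvalues hW.measurable hW.maxEigenvalue_facts.2.1)).2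

/-- There is a nonnegative eigenfunction for `μ(W)`: pass from `f` to `|f|`. -/
theorem exists_nonneg_unitEigen :
    ∃ f, W.UnitEigen W.maxEigenvalue f ∧ ∀ x, 0 ≤ f x := by
  obtain ⟨hpos, ⟨f₀, hf₀⟩, hle⟩ := hW.maxEigenvalue_facts
  obtain ⟨-, f, -, hf, -⟩ := W.exists_unitEigen hW.measurable hpos.ne' hf₀
  have hab := hf.bdd.abs
  have hnorm : ip |f| |f| = 1 := by
    rw [← hf.norm]
    exact integral_congr_ae (Eventually.of_forall fun x => by simp)
  have hff : W.form f f = W.maxEigenvalue := by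
    have : W.op f = W.maxEigenvalue • f := funext hf.op_eq
    rw [form, this, ip_smul_left, hf.norm, mul_one]
  have hge : W.maxEigenvalue ≤ W.form |f| |f| := by
    rw [← hff]
    refine integral_mono ((hf.bdd.op W hW.measurable).mul hf.bdd).integrable
      ((hab.op W hW.measurable).mul hab).integrable fun x => ?_
    refine (le_abs_self _).trans ?_
    simp only [abs_mul, Pi.abs_apply]
    gcongr
    simp only [op]
    refine abs_integral_le_integral_abs.trans (le_of_eq ?_)
    refine integral_congr_ae (Eventually.of_forall fun y => ?_)
    simp [abs_mul, abs_of_nonneg (W.mem_Icc' x y).1]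
  have heq : W.form |f| |f| = W.maxEigenvalue * ip |f| |f| :=
    le_antisymm (hle _ hab.memLp) (by rw [hnorm, mul_one]; exact hge)
  have hae := W.ae_op_eq_of_form_eq hW.measurable (s := 1) one_ne_zero hab
    (fun v hv => by linarith [hle v hv.memLp]) heq
  have heig : W.IsEigenfunction W.maxEigenvalue |f| := by
    refine ⟨hab.memLp, fun h0 => ?_, hae⟩
    rw [ip_congr h0 h0] at hnorm
    simp [ip] at hnorm
  obtain ⟨a, f', ha, hf', haf⟩ := W.exists_unitEigen hW.measurable hpos.ne' heig
  refine ⟨f', hf', fun x => ?_⟩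
  have hae' : ∀ᵐ y, 0 ≤ f' y := by
    filter_upwards [haf] with y hy
    have : 0 ≤ a * f' y := by
      have h2 : |f| y = a * f' y := hy
      rw [← h2]; exact abs_nonneg _
    exact nonneg_of_mul_nonneg_right this ha
  have h1 : 0 ≤ W.maxEigenvalue * f' x := by
    rw [← hf'.op_eq x]
    refine integral_nonneg_of_ae ?_
    filter_upwards [hae'] with y hy
    exact mul_nonneg (W.mem_Icc' x y).1 hy
  exact nonneg_of_mul_nonneg_right h1 hpos

end IsExtremal

theorem UnitEigen.form_self {U : Graphon} {c : ℝ} {f : I → ℝ} (hf : U.UnitEigen c f) :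
    U.form f f = c := by
  have : U.op f = c • f := funext hf.op_eq
  rw [form, this, ip_smul_left, hf.norm, mul_one]

theorem form_sub_form_unitEigen {W : Graphon} {f g : I → ℝ} (hf : W.UnitEigen W.maxEigenvalue f)
    (hg : W.UnitEigen W.minEigenvalue g) : W.form f f - W.form g g = W.spread := by
  rw [hf.form_self, hg.form_self]; rfl

theorem integral_abs_le_one {u : I → ℝ} (hu : IsBdd u) (h : ip u u = 1) : ∫ x, |u x| ≤ 1 := by
  have h1 : ∫ x, |u x| ≤ ∫ x, (1 / 2 * (u x * u x) + 1 / 2) := by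
    refine integral_mono hu.abs.integrable
      (((hu.integrable_mul hu).const_mul _).add (integrable_const _)) fun x => ?_
    simp only
    nlinarith [sq_nonneg (|u x| - 1), abs_mul_abs_self (u x)]
  rw [integral_add ((hu.integrable_mul hu).const_mul _) (integrable_const _),
    integral_const_mul] at h1
  have h2 : ∫ x, u x * u x = 1 := h
  rw [h2] at h1
  norm_num at h1
  linarith

theorem abs_form_le_one (U : Graphon) (hU : Measurable fun p : I × I => U.toFun p.1 p.2)
    {u : I → ℝ} (hu : IsBdd u) (h : ip u u = 1) : |U.form u u| ≤ 1 := by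
  have h1 := integral_abs_le_one hu h
  refine abs_integral_le_integral_abs.trans (le_trans ?_ h1)
  refine integral_mono ((hu.op U hU).mul hu).abs.integrable hu.abs.integrable fun x => ?_
  simp only [abs_mul]
  exact mul_le_of_le_one_left (abs_nonneg _) ((U.abs_op_le hU hu.integrable x).trans h1)

theorem form_self_eq_integral_prod (U : Graphon)
    (hU : Measurable fun p : I × I => U.toFun p.1 p.2) {u : I → ℝ} (hu : IsBdd u) :
    Integrable (fun p : I × I => U.toFun p.1 p.2 * (u p.1 * u p.2)) ∧
    U.form u u = ∫ p : I × I, U.toFun p.1 p.2 * (u p.1 * u p.2) := by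
  have hint : Integrable (fun p : I × I => U.toFun p.1 p.2 * (u p.1 * u p.2))
      (volume.prod volume) :=
    (hu.integrable.mul_prod hu.integrable).bdd_mul (c := 1) hU.aestronglyMeasurable
      (Eventually.of_forall fun p => by simpa using U.abs_le_one p.1 p.2)
  refine ⟨hint, ?_⟩
  rw [Measure.volume_eq_prod, integral_prod _ hint]
  refine integral_congr_ae (Eventually.of_forall fun x => ?_)
  simp only [op]
  rw [← integral_mul_const]
  exact integral_congr_ae (Eventually.of_forall fun y => by ring)

/-- The kernel `f(x) f(y) - g(x) g(y)`, where `f` and `g` are unit eigenfunctions for `μ(W)` and `ν(W)`.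
The spread is its integral against `W`, so an extremal `W` is `1` where it is positive and `0` where
it is negative. -/
def gap (f g : I → ℝ) (x y : I) : ℝ := f x * f y - g x * g y

theorem gap_symm (f g : I → ℝ) (x y : I) : gap f g x y = gap f g y x := by
  simp only [gap]; ring

theorem measurable_gap {f g : I → ℝ} (hf : IsBdd f) (hg : IsBdd g) :
    Measurable fun p : I × I => gap f g p.1 p.2 :=
  ((hf.1.comp measurable_fst).mul (hf.1.comp measurable_snd)).sub
    ((hg.1.comp measurable_fst).mul (hg.1.comp measurable_snd))

theorem form_sub_form (U : Graphon)
    (hU : Measurable fun p : I × I => U.toFun p.1 p.2) {f g : I → ℝ} (hf : IsBdd f)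
    (hg : IsBdd g) :
    Integrable (fun p : I × I => U.toFun p.1 p.2 * gap f g p.1 p.2) ∧
    U.form f f - U.form g g = ∫ p : I × I, U.toFun p.1 p.2 * gap f g p.1 p.2 := by
  obtain ⟨h1, h2⟩ := U.form_self_eq_integral_prod hU hf
  obtain ⟨h3, h4⟩ := U.form_self_eq_integral_prod hU hg
  have heq : (fun p : I × I => U.toFun p.1 p.2 * gap f g p.1 p.2) = fun p : I × I =>
      U.toFun p.1 p.2 * (f p.1 * f p.2) - U.toFun p.1 p.2 * (g p.1 * g p.2) := by
    funext p; simp only [gap]; ring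
  rw [heq]
  refine ⟨h1.sub h3, ?_⟩
  rw [h2, h4, integral_sub h1 h3]

open Classical in
/-- The graphon that is the indicator function of the set where `gap f g` is positive. -/
noncomputable def posGraphon {f g : I → ℝ} (hf : IsBdd f) (hg : IsBdd g) : Graphon where
  toFun x y := if 0 < gap f g x y then 1 else 0
  aemeasurable' := (Measurable.ite (measurableSet_lt measurable_const (measurable_gap hf hg))
    measurable_const measurable_const).aemeasurable
  symm' x y := by rw [gap_symm]
  mem_Icc' x y := by split_ifs <;> simp

open Classical in
/-- The graphon `W`, with its values on the zero set of `gap f g` replaced by the constant `c`. -/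
noncomputable def fillGraphon (W : Graphon) (hW : Measurable fun p : I × I => W.toFun p.1 p.2)
    {f g : I → ℝ} (hf : IsBdd f) (hg : IsBdd g) (c : ℝ) (hc : c ∈ Set.Icc (0 : ℝ) 1) :
    Graphon where
  toFun x y := if gap f g x y = 0 then c else W.toFun x y
  aemeasurable' := (Measurable.ite (measurable_gap hf hg (measurableSet_singleton 0))
    measurable_const hW).aemeasurable
  symm' x y := by rw [gap_symm, W.symm']
  mem_Icc' x y := by split_ifs; exacts [hc, W.mem_Icc' x y]

namespace IsExtremal

variable {W : Graphon} (hW : W.IsExtremal)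
include hW

/-- No trial functions give more than the maximal spread. Since the forms are at most `1` in absolute
value and the spread of `W` exceeds `1`, no assumption on their signs is needed. -/
theorem form_sub_form_le {U : Graphon} (hU : Measurable fun p : I × I => U.toFun p.1 p.2)
    {f g : I → ℝ} (hf : IsBdd f) (hg : IsBdd g) (hf1 : ip f f = 1) (hg1 : ip g g = 1) :
    U.form f f - U.form g g ≤ W.spread := by
  have h1 := hW.one_lt_spread
  have h2 := abs_le.1 (U.abs_form_le_one hU hf hf1)
  have h3 := abs_le.1 (U.abs_form_le_one hU hg hg1)
  by_cases hp : 0 < U.form f f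
  · by_cases hn : U.form g g < 0
    · have := U.sub_le_spread hU hf.memLp hg.memLp hp hn
      rw [hf1, hg1, div_one, div_one] at this
      exact this.trans (hW.spread_le U)
    · linarith
  · linarith

/-- If trial functions `f`, `g` for a graphon `U` attain the maximal spread, then both are
eigenfunctions of `U`. -/
theorem ae_op_eq_of_form_sub_form_eq {U : Graphon}
    (hU : Measurable fun p : I × I => U.toFun p.1 p.2)
    {f g : I → ℝ} (hf : IsBdd f) (hg : IsBdd g) (hf1 : ip f f = 1) (hg1 : ip g g = 1)
    (heq : U.form f f - U.form g g = W.spread) :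
    U.op f =ᵐ[volume] U.form f f • f ∧ U.op g =ᵐ[volume] U.form g g • g := by
  have h1 := hW.one_lt_spread
  have h2 := abs_le.1 (U.abs_form_le_one hU hf hf1)
  have h3 := abs_le.1 (U.abs_form_le_one hU hg hg1)
  have hp : 0 < U.form f f := by linarith
  have hn : U.form g g < 0 := by linarith
  obtain ⟨-, -, h4⟩ := U.maxEigenvalue_of_form_pos hU hf.memLp hp
  obtain ⟨-, -, h5⟩ := U.minEigenvalue_of_form_neg hU hg.memLp hn
  have h6 := h4 f hf.memLp
  have h7 := h5 g hg.memLp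
  rw [hf1] at h6
  rw [hg1] at h7
  have h8 : U.maxEigenvalue - U.minEigenvalue ≤ W.spread := hW.spread_le U
  have h9 : U.maxEigenvalue = U.form f f := by linarith
  have h10 : U.minEigenvalue = U.form g g := by linarith
  rw [h9] at h4
  rw [h10] at h5
  exact ⟨U.ae_op_eq_of_form_eq hU (s := 1) one_ne_zero hf
      (fun v hv => by linarith [h4 v hv.memLp]) (by rw [hf1, mul_one]),
    U.ae_op_eq_of_form_eq hU (s := -1) (by norm_num) hg
      (fun v hv => by linarith [h5 v hv.memLp]) (by rw [hg1, mul_one])⟩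

variable {f g : I → ℝ} (hf : W.UnitEigen W.maxEigenvalue f) (hg : W.UnitEigen W.minEigenvalue g)
include hf hg

theorem ae_eq_of_gap_ne_zero : ∀ᵐ p : I × I, (0 < gap f g p.1 p.2 → W.toFun p.1 p.2 = 1) ∧
    (gap f g p.1 p.2 < 0 → W.toFun p.1 p.2 = 0) := by
  classical
  set U := posGraphon hf.bdd hg.bdd with hU
  have hUm : Measurable fun p : I × I => U.toFun p.1 p.2 :=
    Measurable.ite (measurableSet_lt measurable_const (measurable_gap hf.bdd hg.bdd))
      measurable_const measurable_const
  have h1 := hW.form_sub_form_le hUm hf.bdd hg.bdd hf.norm hg.norm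
  rw [← form_sub_form_unitEigen hf hg] at h1
  obtain ⟨i1, e1⟩ := U.form_sub_form hUm hf.bdd hg.bdd
  obtain ⟨i2, e2⟩ := W.form_sub_form hW.measurable hf.bdd hg.bdd
  rw [e1, e2] at h1
  have hnn : ∀ p : I × I,
      0 ≤ U.toFun p.1 p.2 * gap f g p.1 p.2 - W.toFun p.1 p.2 * gap f g p.1 p.2 := by
    intro p
    have hw := W.mem_Icc' p.1 p.2
    change 0 ≤ (if 0 < gap f g p.1 p.2 then 1 else 0) * _ - _
    split_ifs with h
    · nlinarith [hw.2]
    · nlinarith [hw.1]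
  have h0 : ∫ p : I × I, (U.toFun p.1 p.2 * gap f g p.1 p.2 - W.toFun p.1 p.2 * gap f g p.1 p.2)
      = 0 := by
    refine le_antisymm ?_ (integral_nonneg hnn)
    rw [integral_sub i1 i2]; linarith
  have hae := (integral_eq_zero_iff_of_nonneg hnn (i1.sub i2)).1 h0
  filter_upwards [hae] with p hp
  have hp' : (if 0 < gap f g p.1 p.2 then (1 : ℝ) else 0) * gap f g p.1 p.2
      - W.toFun p.1 p.2 * gap f g p.1 p.2 = 0 := hp
  constructor
  · intro h
    rw [if_pos h, ← sub_mul] at hp'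
    have := (mul_eq_zero.1 hp').resolve_right h.ne'
    linarith
  · intro h
    rw [if_neg (not_lt.2 h.le), ← sub_mul] at hp'
    have := (mul_eq_zero.1 hp').resolve_right h.ne
    linarith

open Classical in
/-- The values of `W` on the zero set `Z` of `gap f g` do not influence the spread, so `f` and `g` are
eigenfunctions whether `W` is set to `1` or to `0` on `Z`. Hence they are eigenfunctions of the
difference of the two operators, whose kernel is the indicator function of `Z`; the two eigenvalues
agree because the two spreads do. -/
theorem exists_integral_gap_eq_zero : ∃ δ : ℝ, ∀ᵐ x,
    (∫ y, if gap f g x y = 0 then f y else 0) = δ * f x ∧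
    (∫ y, if gap f g x y = 0 then g y else 0) = δ * g x := by
  have key : ∀ (c : ℝ) (hc : c ∈ Set.Icc (0 : ℝ) 1), ∃ m n : ℝ, m - n = W.spread ∧
      ∀ᵐ x, (fillGraphon W hW.measurable hf.bdd hg.bdd c hc).op f x = m * f x ∧
        (fillGraphon W hW.measurable hf.bdd hg.bdd c hc).op g x = n * g x := by
    intro c hc
    set U := fillGraphon W hW.measurable hf.bdd hg.bdd c hc with hU
    have hUm : Measurable fun p : I × I => U.toFun p.1 p.2 :=
      Measurable.ite (measurable_gap hf.bdd hg.bdd (measurableSet_singleton 0))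
        measurable_const hW.measurable
    have heq : U.form f f - U.form g g = W.spread := by
      rw [← form_sub_form_unitEigen hf hg, (U.form_sub_form hUm hf.bdd hg.bdd).2,
        (W.form_sub_form hW.measurable hf.bdd hg.bdd).2]
      refine integral_congr_ae (Eventually.of_forall fun p => ?_)
      change (if gap f g p.1 p.2 = 0 then c else W.toFun p.1 p.2) * _ = _
      split_ifs with h
      · simp [h]
      · rfl
    obtain ⟨h1, h2⟩ := hW.ae_op_eq_of_form_sub_form_eq hUm hf.bdd hg.bdd hf.norm hg.norm heq
    refine ⟨_, _, heq, ?_⟩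
    filter_upwards [h1, h2] with x hx hx'
    exact ⟨hx, hx'⟩
  obtain ⟨m₁, n₁, e₁, a₁⟩ := key 1 (by simp)
  obtain ⟨m₀, n₀, e₀, a₀⟩ := key 0 (by simp)
  have hdiff : ∀ u, IsBdd u → ∀ x,
      (fillGraphon W hW.measurable hf.bdd hg.bdd 1 (by simp)).op u x
      - (fillGraphon W hW.measurable hf.bdd hg.bdd 0 (by simp)).op u x
      = ∫ y, if gap f g x y = 0 then u y else 0 := by
    intro u hu x
    have hm : ∀ (c : ℝ) (hc : c ∈ Set.Icc (0 : ℝ) 1),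
        Integrable fun y => (fillGraphon W hW.measurable hf.bdd hg.bdd c hc).toFun x y * u y := by
      intro c hc
      refine Graphon.integrable_mul _ ?_ hu.integrable x
      exact Measurable.ite (measurable_gap hf.bdd hg.bdd (measurableSet_singleton 0))
        measurable_const hW.measurable
    simp only [op]
    rw [← integral_sub (hm 1 _) (hm 0 _)]
    refine integral_congr_ae (Eventually.of_forall fun y => ?_)
    change (if gap f g x y = 0 then (1 : ℝ) else W.toFun x y) * u y
      - (if gap f g x y = 0 then (0 : ℝ) else W.toFun x y) * u y = _
    simp only
    split_ifs <;> ring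
  refine ⟨m₁ - m₀, ?_⟩
  filter_upwards [a₁, a₀] with x h₁ h₀
  rw [← hdiff f hf.bdd, ← hdiff g hg.bdd, h₁.1, h₁.2, h₀.1, h₀.2]
  refine ⟨by ring, ?_⟩
  have : n₁ - n₀ = m₁ - m₀ := by linarith
  rw [← this]; ring

end IsExtremal
end Graphon

/-! ### Positivity of the leading eigenfunction, and reweighting -/

namespace Graphon
namespace IsExtremal

variable {W : Graphon} (hW : W.IsExtremal)
variable {f g : I → ℝ} (hf : W.UnitEigen W.maxEigenvalue f) (hg : W.UnitEigen W.minEigenvalue g)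
include hW hf hg

open Classical in
/-- The eigenfunction for `μ(W)` vanishes almost nowhere. Otherwise `W = 0` between the zero set `T` of
`f` and its complement, and there `gap f g` is negative, that is, `g(x) g(y) > 0`; so `g` has constant
sign on `T`. For `x ∈ T` this makes `ν g(x) = ∫_T W(x,y) g(y) dy` of the sign of `g(x)`. -/
theorem ae_pos (hf0 : ∀ x, 0 ≤ f x) : ∀ᵐ x, 0 < f x := by
  obtain ⟨δ, hδ⟩ := hW.exists_integral_gap_eq_zero hf hg
  have hrule : ∀ᵐ x : I, ∀ᵐ y : I, (0 < gap f g x y → W.toFun x y = 1) ∧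
      (gap f g x y < 0 → W.toFun x y = 0) :=
    Measure.ae_ae_of_ae_prod (hW.ae_eq_of_gap_ne_zero hf hg)
  -- a row of a zero of `f` vanishes where `f` is positive
  have hrow : ∀ x, f x = 0 → ∀ᵐ y, 0 < f y → W.toFun x y = 0 := by
    intro x hx
    have h0 : ∫ y, W.toFun x y * f y = 0 := by
      have := hf.op_eq x
      rw [hx, mul_zero] at this
      exact this
    have := (integral_eq_zero_iff_of_nonneg (fun y => mul_nonneg (W.mem_Icc' x y).1 (hf0 y))
      (W.integrable_mul hW.measurable hf.bdd.integrable x)).1 h0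
    filter_upwards [this] with y hy hpos
    exact (mul_eq_zero.1 hy).resolve_right hpos.ne'
  have hsame : ∀ᵐ x : I, ∀ᵐ y : I, f x = 0 → 0 < f y → 0 < g x * g y := by
    filter_upwards [hδ, hrule] with x hx hr
    by_cases hfx : f x = 0
    swap
    · exact Eventually.of_forall fun y h => absurd h hfx
    have h0 : (∫ y, if gap f g x y = 0 then f y else 0) = 0 := by rw [hx.1, hfx, mul_zero]
    have hm : MeasurableSet {y | gap f g x y = 0} :=
      ((measurable_gap hf.bdd hg.bdd).comp measurable_prodMk_left) (measurableSet_singleton 0)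
    have hint : Integrable fun y => if gap f g x y = 0 then f y else 0 :=
      (hf.bdd.indicator hm).integrable
    have h1 := (integral_eq_zero_iff_of_nonneg (fun y => by
      simp only [Pi.zero_apply]; split_ifs; exacts [hf0 y, le_rfl]) hint).1 h0
    filter_upwards [h1, hr, hrow x hfx] with y hy1 hy2 hy3 _ hpos
    have hne : gap f g x y ≠ 0 := by
      intro h
      simp only [h, if_true, Pi.zero_apply] at hy1
      exact hpos.ne' hy1
    have hnp : ¬ 0 < gap f g x y := by
      intro h
      have := hy2.1 h
      rw [hy3 hpos] at this
      norm_num at this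
    have hlt : gap f g x y < 0 := lt_of_le_of_ne (not_lt.1 hnp) hne
    simp only [gap, hfx] at hlt
    linarith
  by_contra hcon
  have hswap : ∀ᵐ y : I, ∀ᵐ x : I, f x = 0 → 0 < f y → 0 < g x * g y := by
    refine (Measure.ae_ae_comm ?_).1 hsame
    have m1 : MeasurableSet {p : I × I | f p.1 = 0} :=
      (hf.bdd.1.comp measurable_fst) (measurableSet_singleton 0)
    have m2 : MeasurableSet {p : I × I | 0 < f p.2} :=
      measurableSet_lt measurable_const (hf.bdd.1.comp measurable_snd)
    have m3 : MeasurableSet {p : I × I | 0 < g p.1 * g p.2} :=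
      measurableSet_lt measurable_const
        ((hg.bdd.1.comp measurable_fst).mul (hg.bdd.1.comp measurable_snd))
    exact m1.imp (m2.imp m3)
  obtain ⟨y₀, hy₀, hfy₀⟩ : ∃ y₀, (∀ᵐ x : I, f x = 0 → 0 < f y₀ → 0 < g x * g y₀) ∧ 0 < f y₀ := by
    by_contra h
    push Not at h
    have : f =ᵐ[volume] 0 := by
      filter_upwards [hswap] with y hy
      exact le_antisymm (h y hy) (hf0 y)
    have h1 := hf.norm
    rw [ip_congr this this] at h1
    simp [ip] at h1
  have hT : ∃ᵐ x : I, f x = 0 := by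
    intro h
    exact hcon (h.mono fun x hx => lt_of_le_of_ne (hf0 x) fun h' => hx h'.symm)
  obtain ⟨x, hfx, hx⟩ := (hT.and_eventually hy₀).exists
  have hpos := hx hfx hfy₀
  have hge : 0 ≤ W.op (g y₀ • g) x := by
    refine integral_nonneg_of_ae ?_
    filter_upwards [hy₀, hrow x hfx] with y h1 h2
    by_cases hfy : f y = 0
    · have := h1 hfy hfy₀
      simp only [Pi.smul_apply, smul_eq_mul, Pi.zero_apply]
      exact mul_nonneg (W.mem_Icc' x y).1 (by linarith)
    · simp [h2 (lt_of_le_of_ne (hf0 y) (Ne.symm hfy))]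
  rw [op_smul, Pi.smul_apply, hg.op_eq, smul_eq_mul] at hge
  have := hW.minEigenvalue_neg
  nlinarith

open Classical in
/-- The zero set `Z` of `gap f g` is a null set. If the eigenvalue `δ` of its indicator function is zero,
this follows from `f > 0`. If not, `δ f(x)²` and `δ g(x)²` are the integrals of `f(x) f(y)` and
`g(x) g(y)` over the same set, so that `|g| = f`; but then the spread is at most `(∫ f)² ≤ 1`. -/
theorem ae_gap_ne_zero (hf0 : ∀ x, 0 ≤ f x) : ∀ᵐ p : I × I, gap f g p.1 p.2 ≠ 0 := by
  have hpos := hW.ae_pos hf hg hf0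
  obtain ⟨δ, hδ⟩ := hW.exists_integral_gap_eq_zero hf hg
  have hm : ∀ x, MeasurableSet {y | gap f g x y = 0} := fun x =>
    ((measurable_gap hf.bdd hg.bdd).comp measurable_prodMk_left) (measurableSet_singleton 0)
  by_cases h0 : δ = 0
  · rw [Measure.volume_eq_prod, Measure.ae_prod_iff_ae_ae]
    · filter_upwards [hδ] with x hx
      have hint : Integrable fun y => if gap f g x y = 0 then f y else 0 :=
        (hf.bdd.indicator (hm x)).integrable
      have h1 := (integral_eq_zero_iff_of_nonneg (fun y => by
        simp only [Pi.zero_apply]; split_ifs; exacts [hf0 y, le_rfl]) hint).1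
        (by rw [hx.1, h0, zero_mul])
      filter_upwards [h1, hpos] with y hy1 hy2 h
      simp only [h, if_true, Pi.zero_apply] at hy1
      exact hy2.ne' hy1
    · exact ((measurable_gap hf.bdd hg.bdd) (measurableSet_singleton 0)).compl
  · exfalso
    have hsq : ∀ᵐ x, |g x| = f x := by
      filter_upwards [hδ] with x hx
      have e : f x * (∫ y, if gap f g x y = 0 then f y else 0)
          = g x * (∫ y, if gap f g x y = 0 then g y else 0) := by
        rw [← integral_const_mul, ← integral_const_mul]
        refine integral_congr_ae (Eventually.of_forall fun y => ?_)
        simp only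
        split_ifs with h
        · simp only [gap] at h; linarith
        · simp
      rw [hx.1, hx.2] at e
      have e2 : f x ^ 2 = g x ^ 2 := mul_left_cancel₀ h0 (by linarith)
      rw [← abs_of_nonneg (hf0 x)]
      exact ((sq_eq_sq_iff_abs_eq_abs _ _).1 e2).symm
    have h1 := hW.one_lt_spread
    have hprod : ∀ᵐ p : I × I, |g p.1| = f p.1 ∧ |g p.2| = f p.2 := by
      rw [Measure.volume_eq_prod]
      exact (Measure.quasiMeasurePreserving_fst.ae hsq).and
        (Measure.quasiMeasurePreserving_snd.ae hsq)
    obtain ⟨i1, e1⟩ := W.form_sub_form hW.measurable hf.bdd hg.bdd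
    have i2 : Integrable (fun p : I × I => f p.1 * f p.2 - g p.1 * g p.2) := by
      rw [Measure.volume_eq_prod]
      exact (hf.bdd.integrable.mul_prod hf.bdd.integrable).sub
        (hg.bdd.integrable.mul_prod hg.bdd.integrable)
    have hle : W.spread ≤ ∫ p : I × I, (f p.1 * f p.2 - g p.1 * g p.2) := by
      rw [← form_sub_form_unitEigen hf hg, e1]
      refine integral_mono_ae i1 i2 ?_
      filter_upwards [hprod] with p hp
      have hw := W.mem_Icc' p.1 p.2
      have hgap : 0 ≤ gap f g p.1 p.2 := by
        simp only [gap]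
        rw [← hp.1, ← hp.2, ← abs_mul]
        linarith [le_abs_self (g p.1 * g p.2)]
      have : W.toFun p.1 p.2 * gap f g p.1 p.2 ≤ 1 * gap f g p.1 p.2 := by gcongr; exact hw.2
      simpa [gap] using this
    have hval : ∫ p : I × I, (f p.1 * f p.2 - g p.1 * g p.2) = (∫ x, f x) * (∫ x, f x)
        - (∫ x, g x) * (∫ x, g x) := by
      rw [Measure.volume_eq_prod, integral_sub (hf.bdd.integrable.mul_prod hf.bdd.integrable)
        (hg.bdd.integrable.mul_prod hg.bdd.integrable), integral_prod_mul, integral_prod_mul]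
    have hf1 := integral_abs_le_one hf.bdd hf.norm
    simp only [abs_of_nonneg (hf0 _)] at hf1
    have hfn : 0 ≤ ∫ x, f x := integral_nonneg hf0
    rw [hval] at hle
    nlinarith [mul_self_nonneg (∫ x, g x)]

end IsExtremal

/-- The pullback `W(ψ(x), ψ(y))` of a graphon. -/
def comap (W : Graphon) (hW : Measurable fun p : I × I => W.toFun p.1 p.2) (ψ : I → I)
    (hψ : Measurable ψ) : Graphon where
  toFun x y := W.toFun (ψ x) (ψ y)
  aemeasurable' := (hW.comp ((hψ.comp measurable_fst).prodMk (hψ.comp measurable_snd))).aemeasurable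
  symm' x y := W.symm' (ψ x) (ψ y)
  mem_Icc' x y := W.mem_Icc' (ψ x) (ψ y)

/-- Every bounded probability density on the interval is the density of the image of Lebesgue measure
under some map. -/
theorem exists_map_density {D : I → ℝ} (hD : IsBdd D) (hD0 : ∀ x, 0 ≤ D x) (hD1 : ∫ x, D x = 1) :
    ∃ ψ : I → I, Measurable ψ ∧ ∀ u, IsBdd u → ∫ x, u (ψ x) = ∫ x, u x * D x := by
  have hprob : IsProbabilityMeasure ((volume : Measure I).withDensity fun x => ENNReal.ofReal (D x)) := by
    constructor
    rw [withDensity_apply _ MeasurableSet.univ, Measure.restrict_univ]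
    rw [← ofReal_integral_eq_lintegral_ofReal hD.integrable (Eventually.of_forall hD0), hD1]
    simp
  obtain ⟨ψ, hψ, hmap⟩ := Measure.exists_measurable_map_eq
    ((volume : Measure I).withDensity fun x => ENNReal.ofReal (D x))
  refine ⟨ψ, hψ, fun u hu => ?_⟩
  rw [← integral_map (f := u) hψ.aemeasurable hu.1.aestronglyMeasurable, hmap,
    integral_withDensity_eq_integral_toReal_smul hD.1.ennreal_ofReal (by simp)]
  refine integral_congr_ae (Eventually.of_forall fun x => ?_)
  simp [ENNReal.toReal_ofReal (hD0 x), mul_comm]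

theorem _root_.IsBdd.comp {u : I → ℝ} (hu : IsBdd u) {ψ : I → I} (hψ : Measurable ψ) : IsBdd (u ∘ ψ) :=
  ⟨hu.1.comp hψ, hu.2.imp fun _ h x => h (ψ x)⟩

namespace IsExtremal

variable {W : Graphon} (hW : W.IsExtremal)
include hW

/-- Trial functions for the graphon `W` on the interval reweighted by the density `D`: their Rayleigh
quotients still bound the spread, since reweighting amounts to pulling `W` back along a map. -/
theorem reweight_le {D : I → ℝ} (hD : IsBdd D) (hD0 : ∀ x, 0 ≤ D x) (hD1 : ∫ x, D x = 1)
    {u v : I → ℝ} (hu : IsBdd u) (hv : IsBdd v) (hpos : 0 < W.form (u * D) (u * D))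
    (hneg : W.form (v * D) (v * D) < 0) :
    W.form (u * D) (u * D) / ip u (u * D) - W.form (v * D) (v * D) / ip v (v * D) ≤ W.spread := by
  obtain ⟨ψ, hψ, hint⟩ := exists_map_density hD hD0 hD1
  set U := W.comap hW.measurable ψ hψ with hU
  have hUm : Measurable fun p : I × I => U.toFun p.1 p.2 :=
    hW.measurable.comp ((hψ.comp measurable_fst).prodMk (hψ.comp measurable_snd))
  have hform : ∀ w, IsBdd w → U.form (w ∘ ψ) (w ∘ ψ) = W.form (w * D) (w * D) := by
    intro w hw
    have hop : ∀ x, U.op (w ∘ ψ) x = W.op (w * D) (ψ x) := by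
      intro x
      have hb : IsBdd fun z => W.toFun (ψ x) z * w z :=
        IsBdd.mul ⟨W.measurable_right hW.measurable _, 1, W.abs_le_one _⟩ hw
      have := hint _ hb
      refine this.trans (integral_congr_ae (Eventually.of_forall fun y => ?_))
      simp [mul_assoc]
    have hb := ((hw.mul hD).op W hW.measurable).mul hw
    have := hint _ hb
    rw [form, form, ip, ip]
    simp only [hop, Function.comp_apply]
    refine this.trans (integral_congr_ae (Eventually.of_forall fun y => ?_))
    simp [mul_assoc]
  have hip : ∀ w, IsBdd w → ip (w ∘ ψ) (w ∘ ψ) = ip w (w * D) := by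
    intro w hw
    refine (hint _ (hw.mul hw)).trans (integral_congr_ae (Eventually.of_forall fun y => ?_))
    simp [mul_assoc]
  have := U.sub_le_spread hUm (hu.comp hψ).memLp (hv.comp hψ).memLp
    (by rwa [hform u hu]) (by rwa [hform v hv])
  rw [hform u hu, hform v hv, hip u hu, hip v hv] at this
  exact this.trans (hW.spread_le U)

/-- `reweight_le` for the density `1 + ε d` and the trial functions `u + ε a` and `v + ε b`, with small
`ε`. -/
theorem eventually_reweight_le {d u v : I → ℝ} {a b : I → ℝ} (hd : IsBdd d)
    (hd0 : ∫ x, d x = 0) (hu : IsBdd u) (hv : IsBdd v) (ha : IsBdd a) (hb : IsBdd b)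
    (N M : ℝ → ℝ) (hN : ContinuousAt N 0) (hM : ContinuousAt M 0) (hN0 : 0 < N 0) (hM0 : M 0 < 0)
    (hNe : ∀ ε, W.form ((u + ε • a) * (1 + ε • d)) ((u + ε • a) * (1 + ε • d)) = N ε)
    (hMe : ∀ ε, W.form ((v + ε • b) * (1 + ε • d)) ((v + ε • b) * (1 + ε • d)) = M ε) :
    ∀ᶠ ε in 𝓝 (0 : ℝ), N ε / ip (u + ε • a) ((u + ε • a) * (1 + ε • d))
      - M ε / ip (v + ε • b) ((v + ε • b) * (1 + ε • d)) ≤ W.spread := by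
  obtain ⟨C, hC⟩ := hd.2
  have hC0 : 0 ≤ C := (abs_nonneg _).trans (hC 0)
  have hsmall : ∀ᶠ ε in 𝓝 (0 : ℝ), |ε| * (C + 1) < 1 := by
    have : ContinuousAt (fun ε : ℝ => |ε| * (C + 1)) 0 := by fun_prop
    exact this.eventually_lt continuousAt_const (by simp)
  filter_upwards [hsmall, hN.eventually_const_lt hN0, hM.eventually_lt_const hM0] with ε h1 h2 h3
  rw [← hNe ε] at h2 ⊢
  rw [← hMe ε] at h3 ⊢
  refine hW.reweight_le ((IsBdd.const 1).add (hd.smul ε)) (fun x => ?_) ?_ (hu.add (ha.smul ε))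
    (hv.add (hb.smul ε)) h2 h3
  · have h4 : |ε * d x| ≤ |ε| * C := by rw [abs_mul]; gcongr; exact hC x
    have h5 := neg_abs_le (ε * d x)
    have h6 : |ε| * C ≤ |ε| * (C + 1) := by gcongr; linarith
    simp only [Pi.add_apply, Pi.smul_apply, smul_eq_mul]
    linarith
  · have : ∫ x, (1 : ℝ) + ε * d x = 1 := by
      rw [integral_add (integrable_const _) (hd.integrable.const_mul _), integral_const_mul, hd0]
      simp
    exact this

end IsExtremal
end Graphon

/-! ### First and second variation under reweighting -/

namespace Graphon

theorem UnitEigen.form_left {U : Graphon} {c : ℝ} {f : I → ℝ} (hf : U.UnitEigen c f)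
    (v : I → ℝ) : U.form f v = c * ip f v := by
  have : U.op f = c • f := funext hf.op_eq
  rw [form, this, ip_smul_left]

theorem form_quadratic (U : Graphon) (hU : Measurable fun p : I × I => U.toFun p.1 p.2)
    {f P Q : I → ℝ} (hf : IsBdd f) (hP : IsBdd P) (hQ : IsBdd Q) (ε : ℝ) :
    U.form (f + ε • P + ε ^ 2 • Q) (f + ε • P + ε ^ 2 • Q) = U.form f f + 2 * ε * U.form f P
      + ε ^ 2 * (2 * U.form f Q + U.form P P) + 2 * ε ^ 3 * U.form P Q + ε ^ 4 * U.form Q Q := by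
  have h1 := hP.smul ε
  have h2 := hQ.smul (ε ^ 2)
  have h3 := hf.add h1
  have h4 := h3.add h2
  rw [U.form_add_left hU h3 h2 h4, U.form_add_left hU hf h1 h4, U.form_add_right hU h3 h2 hf,
    U.form_add_right hU h3 h2 h1, U.form_add_right hU h3 h2 h2, U.form_add_right hU hf h1 hf,
    U.form_add_right hU hf h1 h1, U.form_add_right hU hf h1 h2]
  simp only [form_smul_left, form_smul_right]
  rw [U.form_comm hU hP hf, U.form_comm hU hQ hf, U.form_comm hU hQ hP]
  ring

theorem ip_quadratic {f w P Q : I → ℝ} (hf : IsBdd f) (hw : IsBdd w) (hP : IsBdd P)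
    (hQ : IsBdd Q) (ε : ℝ) :
    ip (f + ε • w) (f + ε • P + ε ^ 2 • Q) = ip f f + ε * (ip f P + ip w f)
      + ε ^ 2 * (ip f Q + ip w P) + ε ^ 3 * ip w Q := by
  have h0 := hw.smul ε
  have h1 := hP.smul ε
  have h2 := hQ.smul (ε ^ 2)
  have h3 := hf.add h1
  have h4 := h3.add h2
  rw [ip_add_left hf h0 h4, ip_add_right h3 h2 hf, ip_add_right h3 h2 h0, ip_add_right hf h1 hf,
    ip_add_right hf h1 h0]
  simp only [ip_smul_left, ip_smul_right]
  ring

theorem add_smul_mul_one_add_smul (f w d : I → ℝ) (ε : ℝ) :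
    (f + ε • w) * (1 + ε • d) = f + ε • (d * f + w) + ε ^ 2 • (d * w) := by
  funext x
  simp only [Pi.mul_apply, Pi.add_apply, Pi.smul_apply, smul_eq_mul, Pi.one_apply]
  ring

theorem isBdd_zero : IsBdd (0 : I → ℝ) := IsBdd.const 0

namespace IsExtremal

variable {W : Graphon} (hW : W.IsExtremal)
variable {f g : I → ℝ} (hf : W.UnitEigen W.maxEigenvalue f) (hg : W.UnitEigen W.minEigenvalue g)
include hW hf hg

/-- The first variation of the spread under a change of density vanishes. -/
theorem first_variation {d : I → ℝ} (hd : IsBdd d) (hd0 : ∫ x, d x = 0) :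
    W.maxEigenvalue * ip f (d * f) - W.minEigenvalue * ip g (d * g) = 0 := by
  have hμ := hW.maxEigenvalue_pos
  have hν := hW.minEigenvalue_neg
  have hm := hW.measurable
  set μ := W.maxEigenvalue with hμdef
  set ν := W.minEigenvalue with hνdef
  have hexp : ∀ {c : ℝ} {h : I → ℝ}, W.UnitEigen c h → ∀ ε : ℝ,
      W.form ((h + ε • 0) * (1 + ε • d)) ((h + ε • 0) * (1 + ε • d))
        = c + 2 * ε * (c * ip h (d * h)) + ε ^ 2 * W.form (d * h) (d * h) ∧
      ip (h + ε • 0) ((h + ε • 0) * (1 + ε • d)) = 1 + ε * ip h (d * h) := by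
    intro c h hh ε
    have z1 : ∀ v, ip 0 v = 0 := fun v => by simp [ip]
    have z2 : ∀ v, ip v 0 = 0 := fun v => by simp [ip]
    have z3 : ∀ v, W.form v 0 = 0 := fun v => z2 _
    rw [add_smul_mul_one_add_smul, mul_zero, add_zero]
    rw [W.form_quadratic hm hh.bdd (hd.mul hh.bdd) isBdd_zero,
      ip_quadratic hh.bdd isBdd_zero (hd.mul hh.bdd) isBdd_zero, hh.form_self, hh.norm,
      hh.form_left, z1, z1, z1, z2, z3, z3, z3]
    constructor <;> ring
  have hev := hW.eventually_reweight_le hd hd0 hf.bdd hg.bdd isBdd_zero isBdd_zero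
    (fun ε => μ + 2 * ε * (μ * ip f (d * f)) + ε ^ 2 * W.form (d * f) (d * f))
    (fun ε => ν + 2 * ε * (ν * ip g (d * g)) + ε ^ 2 * W.form (d * g) (d * g))
    (by fun_prop) (by fun_prop) (by simpa using hμ) (by simpa using hν)
    (fun ε => (hexp hf ε).1) (fun ε => (hexp hg ε).1)
  simp only [(hexp hf _).2, (hexp hg _).2] at hev
  -- the right-hand side attains its maximum at `0`
  set F : ℝ → ℝ := fun ε =>
    (μ + 2 * ε * (μ * ip f (d * f)) + ε ^ 2 * W.form (d * f) (d * f)) / (1 + ε * ip f (d * f))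
    - (ν + 2 * ε * (ν * ip g (d * g)) + ε ^ 2 * W.form (d * g) (d * g)) / (1 + ε * ip g (d * g))
    with hF
  have hmax : IsLocalMax F 0 := by
    filter_upwards [hev] with ε hε
    refine hε.trans (le_of_eq ?_)
    simp [hF, spread, hμdef, hνdef]
  have hder1 : ∀ c α q : ℝ, HasDerivAt
      (fun ε : ℝ => (c + 2 * ε * (c * α) + ε ^ 2 * q) / (1 + ε * α)) (c * α) 0 := by
    intro c α q
    have h1 : HasDerivAt (fun ε : ℝ => c + 2 * ε * (c * α) + ε ^ 2 * q) (2 * (c * α)) 0 := by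
      have := (((hasDerivAt_id (0 : ℝ)).const_mul 2).mul_const (c * α)).const_add c |>.add
        (((hasDerivAt_id (0 : ℝ)).pow 2).mul_const q)
      exact this.congr_deriv (by simp)
    have h2 : HasDerivAt (fun ε : ℝ => 1 + ε * α) α 0 := by
      have := ((hasDerivAt_id (0 : ℝ)).mul_const α).const_add 1
      simpa using this
    have := h1.div h2 (by simp)
    exact this.congr_deriv (by simp; ring)
  have hder := (hder1 μ (ip f (d * f)) (W.form (d * f) (d * f))).sub
    (hder1 ν (ip g (d * g)) (W.form (d * g) (d * g)))
  exact hmax.hasDerivAt_eq_zero hder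

/-- The points `(f(x), g(x))` lie on an ellipse: in `first_variation`, take for `d` the deviation of
`μ f² - ν g²` from its mean. -/
theorem ae_ellipse : ∀ᵐ x, W.maxEigenvalue * f x ^ 2 - W.minEigenvalue * g x ^ 2 = W.spread := by
  set μ := W.maxEigenvalue with hμdef
  set ν := W.minEigenvalue with hνdef
  have hff := hf.bdd.mul hf.bdd
  have hgg := hg.bdd.mul hg.bdd
  have h1b : IsBdd (1 : I → ℝ) := IsBdd.const 1
  set e : I → ℝ := μ • (f * f) - ν • (g * g) with he
  have heb : IsBdd e := (hff.smul _).sub (hgg.smul _)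
  have i11 : ip (1 : I → ℝ) 1 = 1 := by simp [ip]
  have hfn : ip (f * f) 1 = 1 := by
    rw [← hf.norm]; exact integral_congr_ae (Eventually.of_forall fun x => by simp)
  have hgn : ip (g * g) 1 = 1 := by
    rw [← hg.norm]; exact integral_congr_ae (Eventually.of_forall fun x => by simp)
  have hmean : ip e 1 = μ - ν := by
    rw [he, ip_sub_left (hff.smul _) (hgg.smul _) h1b, ip_smul_left, ip_smul_left, hfn, hgn]
    ring
  set d : I → ℝ := e - (μ - ν) • 1 with hd
  have hdb : IsBdd d := heb.sub (h1b.smul _)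
  have hd1 : ip d 1 = 0 := by
    rw [hd, ip_sub_left heb (h1b.smul _) h1b, ip_smul_left, hmean, i11]; ring
  have hd0 : ∫ x, d x = 0 := by simpa [ip] using hd1
  have hvar := hW.first_variation hf hg hdb hd0
  have hf' : ip f (d * f) = ip (f * f) d :=
    integral_congr_ae (Eventually.of_forall fun x => by simp; ring)
  have hg' : ip g (d * g) = ip (g * g) d :=
    integral_congr_ae (Eventually.of_forall fun x => by simp; ring)
  have hed : ip e d = 0 := by
    rw [he, ip_sub_left (hff.smul _) (hgg.smul _) hdb, ip_smul_left, ip_smul_left, ← hf', ← hg']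
    exact hvar
  have hdd : ip d d = 0 := by
    nth_rw 1 [hd]
    rw [ip_sub_left heb (h1b.smul _) hdb, ip_smul_left, hed, ip_comm, hd1]; ring
  filter_upwards [ae_eq_zero_of_ip_self hdb.memLp hdd] with x hx
  simp only [hd, he, Pi.sub_apply, Pi.smul_apply, Pi.mul_apply, smul_eq_mul, Pi.one_apply,
    Pi.zero_apply] at hx
  rw [spread]
  linarith

/-- The second variation. Reweight by `1 + ε d` with `d` such that the first-order terms vanish, and use
the trial functions `f + (ε/2) A(d f)` and `g`. The coefficient of `ε²` in the gain is at least
`⟨A(d f), d f⟩ - ⟨A(d g), d g⟩ + ‖A(d f)‖² / 2`, so it can only be nonpositive if `A(d f) = 0`. -/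
theorem ae_op_mul_eq_zero {d : I → ℝ} (hd : IsBdd d) (hd0 : ∫ x, d x = 0)
    (hdf : ip f (d * f) = 0) (hQ : W.form (d * g) (d * g) ≤ W.form (d * f) (d * f)) :
    W.op (d * f) =ᵐ[volume] 0 := by
  have hμ := hW.maxEigenvalue_pos
  have hν := hW.minEigenvalue_neg
  have hm := hW.measurable
  have hdg : ip g (d * g) = 0 := by
    have := hW.first_variation hf hg hd hd0
    rw [hdf, mul_zero, zero_sub, neg_eq_zero] at this
    exact (mul_eq_zero.1 this).resolve_left hν.ne
  have hdfb := hd.mul hf.bdd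
  have hdgb := hd.mul hg.bdd
  set μ := W.maxEigenvalue with hμdef
  set ν := W.minEigenvalue with hνdef
  set k := W.op (d * f) with hk
  have hkb : IsBdd k := hdfb.op W hm
  set w : I → ℝ := (1 / 2 : ℝ) • k with hw
  have hwb : IsBdd w := hkb.smul _
  set P := d * f + w with hP
  set Q := d * w with hQdef
  have hPb : IsBdd P := hdfb.add hwb
  have hQb : IsBdd Q := hd.mul hwb
  have z1 : ∀ v, ip 0 v = 0 := fun v => by simp [ip]
  have z2 : ∀ v, ip v 0 = 0 := fun v => by simp [ip]
  have z3 : ∀ v, W.form v 0 = 0 := fun v => z2 _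
  have hN : ∀ ε : ℝ, W.form ((f + ε • w) * (1 + ε • d)) ((f + ε • w) * (1 + ε • d))
      = μ + 2 * ε * (μ * ip f P) + ε ^ 2 * (2 * (μ * ip f Q) + W.form P P)
        + 2 * ε ^ 3 * W.form P Q + ε ^ 4 * W.form Q Q := by
    intro ε
    rw [add_smul_mul_one_add_smul, W.form_quadratic hm hf.bdd hPb hQb, hf.form_self, hf.form_left, hf.form_left]
  have hM : ∀ ε : ℝ, W.form ((g + ε • 0) * (1 + ε • d)) ((g + ε • 0) * (1 + ε • d))
      = ν + ε ^ 2 * W.form (d * g) (d * g) := by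
    intro ε
    rw [add_smul_mul_one_add_smul, mul_zero, add_zero, W.form_quadratic hm hg.bdd hdgb isBdd_zero, hg.form_self,
      hg.form_left, hdg, z3, z3, z3]
    ring
  have hNd : ∀ ε : ℝ, ip (f + ε • w) ((f + ε • w) * (1 + ε • d)) = 1 + ε * (ip f P + ip w f)
      + ε ^ 2 * (ip f Q + ip w P) + ε ^ 3 * ip w Q := by
    intro ε
    rw [add_smul_mul_one_add_smul, ip_quadratic hf.bdd hwb hPb hQb, hf.norm]
  have hMd : ∀ ε : ℝ, ip (g + ε • 0) ((g + ε • 0) * (1 + ε • d)) = 1 := by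
    intro ε
    rw [add_smul_mul_one_add_smul, mul_zero, add_zero, ip_quadratic hg.bdd isBdd_zero hdgb isBdd_zero, hg.norm,
      hdg, z1, z1, z1, z2]
    ring
  have hev := hW.eventually_reweight_le hd hd0 hf.bdd hg.bdd hwb isBdd_zero _ _
    (by fun_prop) (by fun_prop) (by simpa using hμ) (by simpa using hν) hN hM
  simp only [hNd, hMd] at hev
  have hfP : ip f P = ip w f := by
    rw [hP, ip_add_right hdfb hwb hf.bdd, hdf, zero_add, ip_comm]
  have hfQ : ip f Q = ip w P - ip w w := by
    rw [hP, ip_add_right hdfb hwb hwb, add_sub_cancel_right]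
    exact integral_congr_ae (Eventually.of_forall fun x => by
      simp only [hQdef, Pi.mul_apply]; ring)
  set κ := ip k k with hκ
  have hww : ip w w = 1 / 4 * κ := by
    rw [hw, ip_smul_left, ip_smul_right]; ring
  have hPP : W.form P P = W.form (d * f) (d * f) + κ + 1 / 4 * W.form k k := by
    have e1 : W.form (d * f) w = 1 / 2 * κ := by rw [hw, form_smul_right]; rfl
    have e2 : W.form w w = 1 / 4 * W.form k k := by
      rw [hw, form_smul_left, form_smul_right]; ring
    rw [hP, W.form_add_left hm hdfb hwb hPb, W.form_add_right hm hdfb hwb hdfb,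
      W.form_add_right hm hdfb hwb hwb, W.form_comm hm hwb hdfb, e1, e2]
    ring
  set A := W.form P P - μ * ip w w with hA
  set B := 2 * W.form P Q - μ * ip w Q with hB
  set C := W.form Q Q with hC
  set den : ℝ → ℝ := fun ε => 1 + ε * (ip f P + ip w f)
      + ε ^ 2 * (ip f Q + ip w P) + ε ^ 3 * ip w Q with hden
  have hdenc : ContinuousAt den 0 := by fun_prop
  have hden0 : den 0 = 1 := by simp [hden]
  have hdenpos : ∀ᶠ ε in 𝓝 (0 : ℝ), 0 < den ε :=
    hdenc.eventually_const_lt (by rw [hden0]; norm_num)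
  have hlim : Tendsto (fun ε => (A + ε * B + ε ^ 2 * C) / den ε) (𝓝[≠] 0) (𝓝 A) := by
    have h1 : ContinuousAt (fun ε => (A + ε * B + ε ^ 2 * C) / den ε) 0 :=
      ContinuousAt.div (by fun_prop) hdenc (by rw [hden0]; norm_num)
    have h2 := h1.tendsto
    simp only [hden0] at h2
    norm_num at h2
    exact h2.mono_left nhdsWithin_le_nhds
  have hle : A ≤ W.form (d * g) (d * g) := by
    refine le_of_tendsto hlim ?_
    filter_upwards [nhdsWithin_le_nhds hev, nhdsWithin_le_nhds hdenpos, self_mem_nhdsWithin]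
      with ε h1 h2 h3
    have h3' : (ε : ℝ) ≠ 0 := h3
    rw [div_one] at h1
    have hs : W.spread = μ - ν := rfl
    have h4 : (μ + 2 * ε * (μ * ip f P) + ε ^ 2 * (2 * (μ * ip f Q) + W.form P P)
        + 2 * ε ^ 3 * W.form P Q + ε ^ 4 * W.form Q Q) / den ε
        = μ + ε ^ 2 * ((A + ε * B + ε ^ 2 * C) / den ε) := by
      rw [div_eq_iff h2.ne', add_mul, mul_assoc (ε ^ 2), div_mul_cancel₀ _ h2.ne']
      simp only [hden, hA, hB, hC, hfP, hfQ]
      ring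
    have h5 : ε ^ 2 * ((A + ε * B + ε ^ 2 * C) / den ε) ≤ ε ^ 2 * W.form (d * g) (d * g) := by
      have h6 := h1
      change (μ + 2 * ε * (μ * ip f P) + ε ^ 2 * (2 * (μ * ip f Q) + W.form P P)
        + 2 * ε ^ 3 * W.form P Q + ε ^ 4 * W.form Q Q) / den ε - _ ≤ _ at h6
      rw [h4, hs] at h6
      linarith
    exact le_of_mul_le_mul_left h5 (by positivity)
  have hkk := hW.minEigenvalue_facts.2.2 k hkb.memLp
  have hν1 := (abs_le.1 (W.abs_le_one_of_mem_eigenvalues hm hW.minEigenvalue_facts.2.1)).1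
  have hμ1 := hW.maxEigenvalue_le_one
  have hκ0 : 0 ≤ κ := ip_self_nonneg k
  have hκz : κ = 0 := by
    rw [hA, hww, hPP] at hle
    have h1 : -1 * κ ≤ W.form k k := by
      refine le_trans ?_ hkk
      exact mul_le_mul_of_nonneg_right hν1 hκ0
    have h2 : μ * κ ≤ 1 * κ := mul_le_mul_of_nonneg_right hμ1 hκ0
    linarith
  exact ae_eq_zero_of_ip_self hkb.memLp hκz

end IsExtremal
end Graphon

/-! ### Levels of the ratio of the eigenfunctions -/

namespace Graphon

theorem UnitEigen.neg {U : Graphon} {c : ℝ} {f : I → ℝ} (hf : U.UnitEigen c f) :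
    U.UnitEigen c (-f) := by
  refine ⟨hf.bdd.neg, fun x => ?_, ?_⟩
  · have : -f = (-1 : ℝ) • f := by simp
    rw [this, op_smul]
    simp [hf.op_eq]
  · rw [← hf.norm]
    simp [ip]

theorem ip_indicator_left {S : Set I} (hS : MeasurableSet S) (u v : I → ℝ) :
    ip (S.indicator u) v = ∫ x in S, u x * v x := by
  rw [← integral_indicator hS]
  refine integral_congr_ae (Eventually.of_forall fun x => ?_)
  by_cases hx : x ∈ S <;> simp [hx]

namespace IsExtremal

variable {W : Graphon} (hW : W.IsExtremal)
variable {f g : I → ℝ} (hf : W.UnitEigen W.maxEigenvalue f) (hg : W.UnitEigen W.minEigenvalue g)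
include hW hf hg

/-- In terms of the ratio `r = g / f`, the points `x` and `y` are adjacent if and only if
`r(x) r(y) < 1`. -/
theorem ae_ratio (hf0 : ∀ x, 0 ≤ f x) : ∀ᵐ p : I × I,
    (g p.1 / f p.1 * (g p.2 / f p.2) < 1 ∧ W.toFun p.1 p.2 = 1) ∨
    (1 < g p.1 / f p.1 * (g p.2 / f p.2) ∧ W.toFun p.1 p.2 = 0) := by
  have hpos := hW.ae_pos hf hg hf0
  have hpos2 : ∀ᵐ p : I × I, 0 < f p.1 ∧ 0 < f p.2 := by
    rw [Measure.volume_eq_prod]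
    exact (Measure.quasiMeasurePreserving_fst.ae hpos).and
      (Measure.quasiMeasurePreserving_snd.ae hpos)
  filter_upwards [hpos2, hW.ae_gap_ne_zero hf hg hf0, hW.ae_eq_of_gap_ne_zero hf hg]
    with p ⟨h1, h2⟩ h3 ⟨h4, h5⟩
  have h12 := mul_pos h1 h2
  have he : g p.1 / f p.1 * (g p.2 / f p.2) = g p.1 * g p.2 / (f p.1 * f p.2) :=
    div_mul_div_comm _ _ _ _
  rw [he, div_lt_one h12, one_lt_div h12]
  simp only [gap] at h3 h4 h5
  rcases lt_or_gt_of_ne h3 with h | h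
  · exact Or.inr ⟨by linarith, h5 h⟩
  · exact Or.inl ⟨by linarith, h4 h⟩

theorem ae_ratio_ellipse (hf0 : ∀ x, 0 ≤ f x) : ∀ᵐ x, 0 < f x ∧
    f x ^ 2 * (W.maxEigenvalue - W.minEigenvalue * (g x / f x) ^ 2) = W.spread := by
  filter_upwards [hW.ae_pos hf hg hf0, hW.ae_ellipse hf hg] with x h1 h2
  refine ⟨h1, ?_⟩
  rw [← h2]
  field_simp

/-- Three sets of levels `r ∈ [b⁻¹, 1)`, `r ∈ [b, c)` and `r ≥ c` with `1 < b < c` cannot all be present,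
if `r` takes values arbitrarily close to `b` from above.

On the union of the three sets there are adjacent points only within the first one. Hence a
combination `d` of the three indicator functions has a nonnegative value of
`∬ W(x,y) d(x) d(y) (f(x) f(y) - g(x) g(y))`. Choosing `d` orthogonal to `1` and `f²` gives
`A(d f) = 0` by the second variation. Pairing this with `f` on `{r ≥ b⁻¹}`, which only sees the first
set, shows that almost no `r(x)` lies above `b⁻¹` and below `1 / r(y)` for `y` in the first set. So `y`
has the neighbours that a point of level `b` would have, and thus `f(y)` is the value that belongs
to the level `b`; but `f` is a strictly decreasing function of `|r|`. -/
theorem not_three_levels (hf0 : ∀ x, 0 ≤ f x) {b c : ℝ} (hb : 1 < b) (hbc : b < c)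
    (hS1 : volume {x | b⁻¹ ≤ g x / f x ∧ g x / f x < 1} ≠ 0)
    (hS2 : ∀ q, b < q → volume {x | b ≤ g x / f x ∧ g x / f x < q} ≠ 0)
    (hS3 : volume {x | c ≤ g x / f x} ≠ 0) : False := by
  have hμ := hW.maxEigenvalue_pos
  have hν := hW.minEigenvalue_neg
  have hsp : 0 < W.spread := one_pos.trans hW.one_lt_spread
  have hm := hW.measurable
  have hb0 : 0 < b := one_pos.trans hb
  have hrule := hW.ae_ratio hf hg hf0
  have hell := hW.ae_ratio_ellipse hf hg hf0
  have hpos := hW.ae_pos hf hg hf0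
  set μ := W.maxEigenvalue with hμdef
  set ν := W.minEigenvalue with hνdef
  set r : I → ℝ := fun x => g x / f x with hr
  have hrm : Measurable r := hg.bdd.1.div hf.bdd.1
  -- comparison of `f` at two levels of the ratio
  have hcmp : ∀ s t : ℝ, |s| < |t| → W.spread / (μ - ν * t ^ 2) < W.spread / (μ - ν * s ^ 2) := by
    intro s t hst
    have h2 := sq_lt_sq.2 hst
    have h3 : 0 < μ - ν * s ^ 2 := by nlinarith [sq_nonneg s]
    exact div_lt_div_of_pos_left hsp h3 (by nlinarith)
  have hfr : ∀ᵐ x, f x ^ 2 = W.spread / (μ - ν * r x ^ 2) := by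
    filter_upwards [hell] with x hx
    have h3 : 0 < μ - ν * r x ^ 2 := by nlinarith [sq_nonneg (r x)]
    rw [eq_div_iff h3.ne']
    exact hx.2
  set S1 : Set I := {x | b⁻¹ ≤ r x ∧ r x < 1} with hS1def
  set S2 : Set I := {x | b ≤ r x ∧ r x < c} with hS2def
  set S3 : Set I := {x | c ≤ r x} with hS3def
  have m1 : MeasurableSet S1 :=
    (measurableSet_le measurable_const hrm).inter (measurableSet_lt hrm measurable_const)
  have m2 : MeasurableSet S2 :=
    (measurableSet_le measurable_const hrm).inter (measurableSet_lt hrm measurable_const)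
  have m3 : MeasurableSet S3 := measurableSet_le measurable_const hrm
  have hp : ∀ {S : Set I}, volume S ≠ 0 → 0 < volume.real S := fun h =>
    ENNReal.toReal_pos h (measure_ne_top _ _)
  have hv1 : 0 < volume.real S1 := hp hS1
  have hv2 : 0 < volume.real S2 := hp (hS2 c hbc)
  have hv3 : 0 < volume.real S3 := hp hS3
  set φ : Set I → ℝ := fun S => ∫ x in S, f x * f x with hφ
  have hffi : Integrable fun x => f x * f x := hf.bdd.integrable_mul hf.bdd
  -- the value of `f ^ 2` at the level `c` separates `S2` from `S3`
  set K : ℝ := W.spread / (μ - ν * c ^ 2) with hK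
  have hφ3 : φ S3 ≤ K * volume.real S3 := by
    have : φ S3 ≤ ∫ _ in S3, K := by
      refine setIntegral_mono_on_ae hffi.integrableOn (integrable_const _) m3 ?_
      filter_upwards [hfr] with x hx hxS
      rw [← sq, hx]
      rcases eq_or_lt_of_le (show c ≤ r x from hxS) with h | h
      · rw [← h]
      · refine (hcmp c (r x) ?_).le
        rw [abs_of_pos (by linarith), abs_of_pos (by linarith)]; exact h
    simpa [mul_comm] using this
  have hφ2 : K * volume.real S2 < φ S2 := by
    have h1 : 0 < ∫ x in S2, (f x * f x - K) := by
      rw [setIntegral_pos_iff_support_of_nonneg_ae]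
      · have : volume (S2 \ (Function.support (fun x => f x * f x - K) ∩ S2)) = 0 := by
          rw [measure_eq_zero_iff_ae_notMem]
          filter_upwards [hfr] with x hx hxS
          refine hxS.2 ⟨?_, hxS.1⟩
          have hx1 : b ≤ r x ∧ r x < c := hxS.1
          have := hcmp (r x) c (by
            rw [abs_of_pos (by linarith), abs_of_pos (by linarith)]; exact hx1.2)
          rw [← hx] at this
          rw [Function.mem_support]
          nlinarith
        rw [pos_iff_ne_zero]
        intro h0
        refine hS2 c hbc ?_
        refine measure_mono_null (t := (S2 \ (Function.support (fun x => f x * f x - K) ∩ S2)) ∪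
          (Function.support (fun x => f x * f x - K) ∩ S2)) ?_ (measure_union_null this h0)
        intro x hx
        by_cases hxs : x ∈ Function.support (fun x => f x * f x - K) ∩ S2
        · exact Or.inr hxs
        · exact Or.inl ⟨hx, hxs⟩
      · rw [EventuallyLE, ae_restrict_iff' m2]
        filter_upwards [hfr] with x hx hxS
        have hx1 : b ≤ r x ∧ r x < c := hxS
        have := hcmp (r x) c (by
          rw [abs_of_pos (by linarith), abs_of_pos (by linarith)]; exact hx1.2)
        rw [← hx] at this
        simp only [Pi.zero_apply]
        nlinarith
      · exact (hffi.sub (integrable_const _)).integrableOn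
    rw [integral_sub hffi.integrableOn (integrable_const _)] at h1
    simp only [integral_const, measureReal_restrict_apply_univ, smul_eq_mul] at h1
    have : φ S2 = ∫ x in S2, f x * f x := rfl
    linarith
  set d1 := volume.real S2 * φ S3 - volume.real S3 * φ S2 with hd1
  set d2 := volume.real S3 * φ S1 - volume.real S1 * φ S3 with hd2
  set d3 := volume.real S1 * φ S2 - volume.real S2 * φ S1 with hd3
  have hd1neg : d1 < 0 := by
    have h1 : volume.real S2 * φ S3 ≤ volume.real S2 * (K * volume.real S3) := by gcongr
    have h2 : volume.real S3 * (K * volume.real S2) < volume.real S3 * φ S2 := by gcongr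
    rw [hd1]; nlinarith
  have h1b : IsBdd (1 : I → ℝ) := IsBdd.const 1
  set χ1 := S1.indicator (1 : I → ℝ) with hχ1
  set χ2 := S2.indicator (1 : I → ℝ) with hχ2
  set χ3 := S3.indicator (1 : I → ℝ) with hχ3
  have b1 : IsBdd χ1 := h1b.indicator m1
  have b2 : IsBdd χ2 := h1b.indicator m2
  have b3 : IsBdd χ3 := h1b.indicator m3
  set d : I → ℝ := d1 • χ1 + d2 • χ2 + d3 • χ3 with hd
  have hdb : IsBdd d := ((b1.smul _).add (b2.smul _)).add (b3.smul _)
  have hipd : ∀ u, IsBdd u → ip d u = d1 * (∫ x in S1, u x) + d2 * (∫ x in S2, u x)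
      + d3 * (∫ x in S3, u x) := by
    intro u hu
    rw [hd, ip_add_left ((b1.smul _).add (b2.smul _)) (b3.smul _) hu,
      ip_add_left (b1.smul _) (b2.smul _) hu, ip_smul_left, ip_smul_left, ip_smul_left,
      hχ1, hχ2, hχ3, ip_indicator_left m1, ip_indicator_left m2, ip_indicator_left m3]
    simp
  have hd0 : ∫ x, d x = 0 := by
    have h := hipd 1 h1b
    have h' : ip d 1 = ∫ x, d x := by simp [ip]
    rw [h'] at h
    rw [h]
    simp only [Pi.one_apply, integral_const, measureReal_restrict_apply_univ, smul_eq_mul, mul_one]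
    rw [hd1, hd2, hd3]; ring
  have hdf : ip f (d * f) = 0 := by
    have h := hipd (f * f) (hf.bdd.mul hf.bdd)
    have h' : ip f (d * f) = ip d (f * f) :=
      integral_congr_ae (Eventually.of_forall fun x => by simp only [Pi.mul_apply]; ring)
    rw [h', h]
    change d1 * φ S1 + d2 * φ S2 + d3 * φ S3 = 0
    rw [hd1, hd2, hd3]; ring
  -- outside `S1 × S1` the product of two levels is at least one
  have hdval : ∀ x, (d x = d1 ∧ b⁻¹ ≤ r x ∧ r x < 1) ∨ b ≤ r x ∨ d x = 0 := by
    intro x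
    by_cases hx2 : b ≤ r x
    · exact Or.inr (Or.inl hx2)
    have n2 : x ∉ S2 := fun h => hx2 h.1
    have n3 : x ∉ S3 := fun h => hx2 (hbc.le.trans h)
    by_cases hx1 : x ∈ S1
    · left
      refine ⟨?_, hx1⟩
      simp [hd, hχ1, hχ2, hχ3, n2, n3, hx1]
    · right; right
      simp [hd, hχ1, hχ2, hχ3, n2, n3, hx1]
  have hQ : W.form (d * g) (d * g) ≤ W.form (d * f) (d * f) := by
    obtain ⟨i1, e1⟩ := W.form_self_eq_integral_prod hm (hdb.mul hg.bdd)
    obtain ⟨i2, e2⟩ := W.form_self_eq_integral_prod hm (hdb.mul hf.bdd)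
    rw [e1, e2]
    refine integral_mono_ae i1 i2 ?_
    have hgap := hW.ae_eq_of_gap_ne_zero hf hg
    filter_upwards [hrule, hgap] with p h1 h2
    simp only [Pi.mul_apply]
    rcases h1 with ⟨h1, hw⟩ | ⟨-, hw⟩
    swap
    · simp [hw]
    rw [hw]
    have hgp : 0 ≤ gap f g p.1 p.2 := by
      by_contra h
      have := h2.2 (not_le.1 h)
      rw [hw] at this; norm_num at this
    have hdd : 0 ≤ d p.1 * d p.2 := by
      have h1' : r p.1 * r p.2 < 1 := h1
      have hbb : b⁻¹ * b = 1 := inv_mul_cancel₀ hb0.ne'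
      have hbi : 0 < b⁻¹ := inv_pos.2 hb0
      rcases hdval p.1 with ⟨ha, hb1, hb2⟩ | ha | ha
      · rcases hdval p.2 with ⟨hc, hc1, hc2⟩ | hc | hc
        · rw [ha, hc]; exact mul_self_nonneg _
        · exfalso
          have : b⁻¹ * b ≤ r p.1 * r p.2 := mul_le_mul hb1 hc hb0.le (hbi.le.trans hb1)
          linarith
        · simp [hc]
      · rcases hdval p.2 with ⟨hc, hc1, hc2⟩ | hc | hc
        · exfalso
          have : b * b⁻¹ ≤ r p.1 * r p.2 := mul_le_mul ha hc1 hbi.le (hb0.le.trans ha)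
          linarith
        · exfalso
          have : b * b ≤ r p.1 * r p.2 := mul_le_mul ha hc hb0.le (hb0.le.trans ha)
          nlinarith
        · simp [hc]
      · simp [ha]
    have := mul_nonneg hdd hgp
    simp only [gap] at this
    linarith
  have hop := hW.ae_op_mul_eq_zero hf hg hdb hd0 hdf hQ
  set S : Set I := {x | b⁻¹ ≤ r x} with hSdef
  have mS : MeasurableSet S := measurableSet_le measurable_const hrm
  set h : I → ℝ := S.indicator f with hh
  have hhb : IsBdd h := hf.bdd.indicator mS
  have hh0 : ∀ x, 0 ≤ h x := fun x => Set.indicator_nonneg (fun x _ => hf0 x) x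
  have hoph : ∀ x, 0 ≤ W.op h x := fun x =>
    integral_nonneg fun y => mul_nonneg (W.mem_Icc' x y).1 (hh0 y)
  have hrows : ∀ᵐ x : I, ∀ᵐ y : I, (r x * r y < 1 ∧ W.toFun x y = 1) ∨
      (1 < r x * r y ∧ W.toFun x y = 0) := Measure.ae_ae_of_ae_prod hrule
  have hpair : ip (W.op h) (d * f) = 0 := by
    have : W.form h (d * f) = W.form (d * f) h := W.form_comm hm hhb (hdb.mul hf.bdd)
    change W.form h (d * f) = 0
    rw [this, form, ip_congr hop (ae_eq_refl h)]
    simp [ip]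
  have hhigh : ∀ᵐ x, b ≤ r x → W.op h x = 0 := by
    filter_upwards [hrows] with x hx hbx
    have : W.op h x = ∫ _ : I, (0 : ℝ) := by
      refine integral_congr_ae ?_
      filter_upwards [hx] with y hy
      by_cases hyS : y ∈ S
      · have hy1 : b⁻¹ ≤ r y := hyS
        have : b * b⁻¹ ≤ r x * r y := mul_le_mul hbx hy1 (inv_pos.2 hb0).le (hb0.le.trans hbx)
        rw [mul_inv_cancel₀ hb0.ne'] at this
        rcases hy with ⟨hy, -⟩ | ⟨-, hy⟩
        · linarith
        · simp [hy]
      · simp [hh, hyS]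
    rw [this]; simp
  have hlow : ∀ᵐ x, x ∈ S1 → W.op h x = 0 := by
    have e : ip (W.op h) (d * f) = d1 * ∫ x, W.op h x * (χ1 x * f x) := by
      rw [← integral_const_mul]
      refine integral_congr_ae ?_
      filter_upwards [hhigh] with x hx
      simp only [Pi.mul_apply]
      by_cases hbx : b ≤ r x
      · rw [hx hbx]; ring
      · have n2 : x ∉ S2 := fun h => hbx h.1
        have n3 : x ∉ S3 := fun h => hbx (hbc.le.trans h)
        simp only [hd, hχ2, hχ3, Pi.add_apply, Pi.smul_apply, smul_eq_mul,
          Set.indicator_of_notMem n2, Set.indicator_of_notMem n3]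
        ring
    rw [hpair] at e
    have e0 := (mul_eq_zero.1 e.symm).resolve_left hd1neg.ne
    have hnn : ∀ x, 0 ≤ W.op h x * (χ1 x * f x) := fun x =>
      mul_nonneg (hoph x) (mul_nonneg (Set.indicator_nonneg (fun _ _ => zero_le_one) x) (hf0 x))
    have := (integral_eq_zero_iff_of_nonneg hnn
      ((hhb.op W hm).integrable_mul (b1.mul hf.bdd))).1 e0
    filter_upwards [this, hpos] with x hx hfx hxS
    simp only [hχ1, Set.indicator_of_mem hxS, Pi.one_apply, one_mul, Pi.zero_apply] at hx
    exact (mul_eq_zero.1 hx).resolve_right hfx.ne'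
  set Φ : ℝ := ∫ x in {x | r x < b⁻¹}, f x with hΦ
  have mlt : ∀ t : ℝ, MeasurableSet {x | r x < t} := fun t => measurableSet_lt hrm measurable_const
  have hΦ0 : 0 ≤ Φ := integral_nonneg hf0
  -- on `S1` the value of `f` is the one that the level `b` would have
  have hval1 : ∀ᵐ x, x ∈ S1 → μ * f x = Φ := by
    filter_upwards [hlow, hrows] with x hx hrx hxS
    have h0 := hx hxS
    have hxS' : b⁻¹ ≤ r x ∧ r x < 1 := hxS
    have hxpos : 0 < r x := (inv_pos.2 hb0).trans_le hxS'.1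
    rw [← hf.op_eq x]
    have hsplit : W.op f x = W.op h x + ∫ y, Set.indicator {x | r x < b⁻¹} f y := by
      simp only [op]
      rw [← integral_add (W.integrable_mul hm hhb.integrable x)
        ((hf.bdd.indicator (mlt _)).integrable)]
      refine integral_congr_ae ?_
      filter_upwards [hrx] with y hy
      by_cases hyS : b⁻¹ ≤ r y
      · have h1 : y ∈ S := hyS
        have h2 : y ∉ {x | r x < b⁻¹} := fun h => absurd hyS (not_le.2 h)
        simp [hh, h1, Set.indicator_of_notMem h2]
      · have h1 : y ∉ S := hyS
        have h2 : y ∈ {x | r x < b⁻¹} := not_le.1 hyS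
        have hlt : r x * r y < 1 := by
          have h3 : r y < 1 := (not_le.1 hyS).trans (inv_lt_one_of_one_lt₀ hb)
          nlinarith
        rcases hy with ⟨-, hy⟩ | ⟨hy, -⟩
        · simp [hh, h1, Set.indicator_of_mem h2, hy]
        · linarith
    rw [hsplit, h0, zero_add, integral_indicator (mlt _)]
  -- approaching the level `b` from above
  have hq : ∀ q, b < q → (∫ x in {x | r x < q⁻¹}, f x) ^ 2 ≤
      μ ^ 2 * (W.spread / (μ - ν * b ^ 2)) := by
    intro q hbq
    have hq0 : 0 < q := hb0.trans hbq
    have hfreq : ∃ᵐ x : I, b ≤ r x ∧ r x < q := by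
      intro hcon
      exact hS2 q hbq (measure_eq_zero_iff_ae_notMem.2 hcon)
    obtain ⟨x, ⟨hbx, hxq⟩, hrx, hfx⟩ := (hfreq.and_eventually (hrows.and hfr)).exists
    have hxpos : 0 < r x := hb0.trans_le hbx
    have h1 : ∫ x in {x | r x < q⁻¹}, f x ≤ μ * f x := by
      rw [← hf.op_eq x, ← integral_indicator (mlt _)]
      refine integral_mono_ae (hf.bdd.indicator (mlt _)).integrable
        (W.integrable_mul hm hf.bdd.integrable x) ?_
      filter_upwards [hrx] with y hy
      by_cases hyS : r y < q⁻¹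
      · have h2 : y ∈ {x | r x < q⁻¹} := hyS
        have hlt : r x * r y < 1 := by
          rcases le_or_gt (r y) 0 with h3 | h3
          · nlinarith
          · have : r x * r y < q * q⁻¹ := mul_lt_mul'' hxq hyS hxpos.le h3.le
            rwa [mul_inv_cancel₀ hq0.ne'] at this
        rcases hy with ⟨-, hy⟩ | ⟨hy, -⟩
        · simp [Set.indicator_of_mem h2, hy]
        · linarith
      · have h2 : y ∉ {x | r x < q⁻¹} := hyS
        simp only [Set.indicator_of_notMem h2]
        exact mul_nonneg (W.mem_Icc' x y).1 (hf0 y)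
    have h0 : 0 ≤ ∫ x in {x | r x < q⁻¹}, f x := integral_nonneg hf0
    calc (∫ x in {x | r x < q⁻¹}, f x) ^ 2 ≤ (μ * f x) ^ 2 := by gcongr
      _ = μ ^ 2 * f x ^ 2 := by ring
      _ ≤ _ := by
        gcongr
        rw [hfx]
        rcases eq_or_lt_of_le hbx with h | h
        · rw [← h]
        · refine (hcmp b (r x) ?_).le
          rw [abs_of_pos hb0, abs_of_pos hxpos]; exact h
  have hΦle : Φ ^ 2 ≤ μ ^ 2 * (W.spread / (μ - ν * b ^ 2)) := by
    set q : ℕ → ℝ := fun n => b + 1 / ((n : ℝ) + 1) with hqdef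
    have hqb : ∀ n, b < q n := fun n => by simp only [hqdef]; linarith [Nat.one_div_pos_of_nat (α := ℝ) (n := n)]
    have hqlim : Tendsto q atTop (𝓝 b) := by
      have := tendsto_one_div_add_atTop_nhds_zero_nat (𝕜 := ℝ) |>.const_add b
      simpa [hqdef] using this
    have hqanti : Antitone q := fun m n hmn => by
      simp only [hqdef]; gcongr
    have hmono : Monotone fun n => {x | r x < (q n)⁻¹} := by
      intro m n hmn x hx
      have hx' : r x < (q m)⁻¹ := hx
      exact hx'.trans_le (inv_anti₀ (hb0.trans (hqb n)) (hqanti hmn))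
    have hU : (⋃ n, {x | r x < (q n)⁻¹}) = {x | r x < b⁻¹} := by
      ext x
      simp only [Set.mem_iUnion]
      constructor
      · rintro ⟨n, hn⟩
        have hn' : r x < (q n)⁻¹ := hn
        exact hn'.trans_le (inv_anti₀ hb0 (hqb n).le)
      · intro hx
        have h1 : Tendsto (fun n => (q n)⁻¹) atTop (𝓝 b⁻¹) := hqlim.inv₀ hb0.ne'
        exact (h1.eventually_const_lt (show r x < b⁻¹ from hx)).exists
    have hlim := tendsto_setIntegral_of_monotone (μ := (volume : Measure I)) (f := f)
      (fun n => mlt (q n)⁻¹) hmono hf.bdd.integrable.integrableOn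
    rw [hU] at hlim
    exact le_of_tendsto (hlim.pow 2) (Eventually.of_forall fun n => hq (q n) (hqb n))
  have hfreq : ∃ᵐ x : I, x ∈ S1 := fun hcon => hS1 (measure_eq_zero_iff_ae_notMem.2 hcon)
  obtain ⟨x, hxS, hx1, hx2⟩ := (hfreq.and_eventually (hval1.and hfr)).exists
  have hxS' : b⁻¹ ≤ r x ∧ r x < 1 := hxS
  have hxpos : 0 < r x := (inv_pos.2 hb0).trans_le hxS'.1
  have h1 := hcmp (r x) b (by rw [abs_of_pos hxpos, abs_of_pos hb0]; linarith [hxS'.2])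
  rw [← hx2] at h1
  rw [← hx1 hxS, mul_pow] at hΦle
  have := le_of_mul_le_mul_left hΦle (by positivity)
  linarith

end IsExtremal
end Graphon

/-! ### The top level -/

namespace Graphon
namespace IsExtremal

variable {W : Graphon} (hW : W.IsExtremal)
variable {f g : I → ℝ} (hf : W.UnitEigen W.maxEigenvalue f) (hg : W.UnitEigen W.minEigenvalue g)
include hW hg

/-- A nonnegative `g` would give `ν g = A_W g ≥ 0`. -/
theorem not_ae_nonneg : ¬ ∀ᵐ x, 0 ≤ g x := by
  intro h
  have hν := hW.minEigenvalue_neg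
  have hz : g =ᵐ[volume] 0 := by
    filter_upwards [h] with x hx
    have h1 : 0 ≤ W.minEigenvalue * g x := by
      rw [← hg.op_eq x]
      refine integral_nonneg_of_ae ?_
      filter_upwards [h] with y hy
      exact mul_nonneg (W.mem_Icc' x y).1 hy
    refine le_antisymm (not_lt.1 fun hlt => ?_) hx
    exact absurd h1 (not_le.2 (mul_neg_of_neg_of_pos hν hlt))
  have h1 := hg.norm
  rw [ip_congr hz hz] at h1
  simp [ip] at h1

include hf

/-- The ratio is essentially bounded above: points with `g > 0` are adjacent to all points with `g < 0`,
which bounds `f` from below there. -/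
theorem exists_ratio_le (hf0 : ∀ x, 0 ≤ f x) : ∃ C, ∀ᵐ x, g x / f x ≤ C := by
  have hμ := hW.maxEigenvalue_pos
  have hpos := hW.ae_pos hf hg hf0
  have hrows : ∀ᵐ x : I, ∀ᵐ y : I, (g x / f x * (g y / f y) < 1 ∧ W.toFun x y = 1) ∨
      (1 < g x / f x * (g y / f y) ∧ W.toFun x y = 0) :=
    Measure.ae_ae_of_ae_prod (hW.ae_ratio hf hg hf0)
  have hm : MeasurableSet {y | g y < 0} := measurableSet_lt hg.bdd.1 measurable_const
  set β : ℝ := ∫ y, Set.indicator {y | g y < 0} f y with hβ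
  have hnn : ∀ y, 0 ≤ Set.indicator {y | g y < 0} f y := fun y =>
    Set.indicator_nonneg (fun y _ => hf0 y) y
  have hβ0 : 0 < β := by
    refine lt_of_le_of_ne (integral_nonneg hnn) fun h0 => hW.not_ae_nonneg hg ?_
    have := (integral_eq_zero_iff_of_nonneg hnn (hf.bdd.indicator hm).integrable).1 h0.symm
    filter_upwards [this, hpos] with y h1 h2
    by_contra h
    have h3 : y ∈ {y | g y < 0} := not_le.1 h
    rw [Set.indicator_of_mem h3] at h1
    exact h2.ne' h1
  obtain ⟨C, hC⟩ := hg.bdd.2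
  have hC0 : 0 ≤ C := (abs_nonneg _).trans (hC 0)
  refine ⟨C * W.maxEigenvalue / β, ?_⟩
  filter_upwards [hpos, hrows] with x hx hrx
  by_cases hgx : g x ≤ 0
  · exact (div_nonpos_of_nonpos_of_nonneg hgx hx.le).trans (by positivity)
  have hle : β ≤ W.maxEigenvalue * f x := by
    rw [← hf.op_eq x]
    refine integral_mono_ae (hf.bdd.indicator hm).integrable
      (W.integrable_mul hW.measurable hf.bdd.integrable x) ?_
    filter_upwards [hrx, hpos] with y hy hfy
    by_cases hgy : g y < 0
    · have h3 : y ∈ {y | g y < 0} := hgy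
      have h4 : g x / f x * (g y / f y) < 0 :=
        mul_neg_of_pos_of_neg (div_pos (not_le.1 hgx) hx) (div_neg_of_neg_of_pos hgy hfy)
      rcases hy with ⟨-, hy⟩ | ⟨hy, -⟩
      · simp [Set.indicator_of_mem h3, hy]
      · linarith
    · have h3 : y ∉ {y | g y < 0} := hgy
      simp only [Set.indicator_of_notMem h3]
      exact mul_nonneg (W.mem_Icc' x y).1 (hf0 y)
  rw [div_le_div_iff₀ hx hβ0]
  have h5 : g x ≤ C := (le_abs_self _).trans (hC x)
  calc g x * β ≤ C * β := by gcongr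
    _ ≤ C * (W.maxEigenvalue * f x) := by gcongr
    _ = C * W.maxEigenvalue * f x := by ring

/-- `not_three_levels` without the assumption on values close to `b`: replace `b` by the essential
infimum of the levels in `[b, c)`, which only enlarges the first set. -/
theorem three_levels (hf0 : ∀ x, 0 ≤ f x) {b c c' : ℝ} (hb : 1 < b) (hcc : c < c')
    (hS3 : volume {x | c' ≤ g x / f x} ≠ 0) :
    volume {x | b⁻¹ ≤ g x / f x ∧ g x / f x < 1} = 0 ∨
      volume {x | b ≤ g x / f x ∧ g x / f x < c} = 0 := by
  by_contra hcon
  push Not at hcon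
  obtain ⟨hS1, hS2⟩ := hcon
  set A : Set ℝ := {q | b ≤ q ∧ volume {x | b ≤ g x / f x ∧ g x / f x < q} ≠ 0} with hA
  have hbc : b ≤ c := by
    by_contra h
    refine hS2 ?_
    have : {x | b ≤ g x / f x ∧ g x / f x < c} = ∅ := by
      ext x
      simp only [Set.mem_empty_iff_false, iff_false]
      rintro ⟨h1, h2⟩
      linarith
    rw [this, measure_empty]
  have hcA : c ∈ A := ⟨hbc, hS2⟩
  have hbd : BddBelow A := ⟨b, fun q hq => hq.1⟩
  set b' := sInf A with hb'
  have hbb' : b ≤ b' := le_csInf ⟨c, hcA⟩ fun q hq => hq.1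
  have hb'c : b' ≤ c := csInf_le hbd hcA
  have hnull : volume {x | b ≤ g x / f x ∧ g x / f x < b'} = 0 := by
    have hsub : {x | b ≤ g x / f x ∧ g x / f x < b'} ⊆
        ⋃ n : ℕ, {x | b ≤ g x / f x ∧ g x / f x < b' - 1 / ((n : ℝ) + 1)} := by
      rintro x ⟨h1, h2⟩
      obtain ⟨n, hn⟩ := exists_nat_one_div_lt (sub_pos.2 h2)
      exact Set.mem_iUnion.2 ⟨n, h1, by linarith⟩
    refine measure_mono_null hsub (measure_iUnion_null fun n => ?_)
    by_contra h
    have hlt : b' - 1 / ((n : ℝ) + 1) < b' := by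
      have : 0 < 1 / ((n : ℝ) + 1) := Nat.one_div_pos_of_nat
      linarith
    have hle : b ≤ b' - 1 / ((n : ℝ) + 1) := by
      by_contra hlt'
      refine h ?_
      have : {x | b ≤ g x / f x ∧ g x / f x < b' - 1 / ((n : ℝ) + 1)} = ∅ := by
        ext x
        simp only [Set.mem_empty_iff_false, iff_false]
        rintro ⟨h1, h2⟩
        linarith
      rw [this, measure_empty]
    exact absurd (csInf_le hbd (show _ ∈ A from ⟨hle, h⟩)) (not_le.2 hlt)
  refine hW.not_three_levels hf hg hf0 (b := b') (c := c') (by linarith) (by linarith) ?_ ?_ hS3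
  · intro h
    refine hS1 (measure_mono_null ?_ h)
    rintro x ⟨h1, h2⟩
    exact ⟨(inv_anti₀ (by linarith) hbb').trans h1, h2⟩
  · intro q hq h
    obtain ⟨q', hq'A, hq'⟩ := exists_lt_of_csInf_lt ⟨c, hcA⟩ hq
    refine hq'A.2 (measure_mono_null (t := {x | b ≤ g x / f x ∧ g x / f x < b'} ∪
      {x | b' ≤ g x / f x ∧ g x / f x < q}) ?_ (measure_union_null hnull h))
    rintro x ⟨h1, h2⟩
    rcases lt_or_ge (g x / f x) b' with h3 | h3
    · exact Or.inl ⟨h1, h3⟩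
    · exact Or.inr ⟨h3, h2.trans hq'⟩

/-- Let `s` be the essential supremum of the ratio (or `1`, if that is larger). Points with a level in
`[0, 1)` are adjacent to all points with a level below `s`. -/
theorem exists_top_level (hf0 : ∀ x, 0 ≤ f x) : ∃ s : ℝ, 1 ≤ s ∧ (∀ᵐ x, g x / f x ≤ s) ∧
    ∀ᵐ p : I × I, g p.1 / f p.1 < 1 → g p.2 / f p.2 < s → 0 ≤ g p.1 / f p.1 →
      g p.1 / f p.1 * (g p.2 / f p.2) < 1 := by
  obtain ⟨C, hC⟩ := hW.exists_ratio_le hf hg hf0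
  set A : Set ℝ := {t | 1 ≤ t ∧ ∀ᵐ x, g x / f x ≤ t} with hA
  have hne : A.Nonempty := ⟨max 1 C, le_max_left _ _, hC.mono fun x hx => hx.trans (le_max_right _ _)⟩
  have hbd : BddBelow A := ⟨1, fun t ht => ht.1⟩
  set s := sInf A with hs
  have hs1 : 1 ≤ s := le_csInf hne fun t ht => ht.1
  have hsle : ∀ᵐ x, g x / f x ≤ s := by
    have : ∀ᵐ x, ∀ n : ℕ, g x / f x ≤ s + 1 / ((n : ℝ) + 1) := by
      refine ae_all_iff.2 fun n => ?_
      have hpos : 0 < 1 / ((n : ℝ) + 1) := Nat.one_div_pos_of_nat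
      obtain ⟨t, htA, ht⟩ := exists_lt_of_csInf_lt hne (show sInf A < s + 1 / ((n : ℝ) + 1) by linarith)
      exact htA.2.mono fun x hx => hx.trans ht.le
    filter_upwards [this] with x hx
    by_contra h
    obtain ⟨n, hn⟩ := exists_nat_one_div_lt (sub_pos.2 (not_le.1 h))
    linarith [hx n]
  have htop : ∀ c, 1 ≤ c → c < s → volume {x | c ≤ g x / f x} ≠ 0 := by
    intro c hc1 hcs h
    have : c ∈ A := by
      refine ⟨hc1, ?_⟩
      filter_upwards [measure_eq_zero_iff_ae_notMem.1 h] with x hx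
      exact (not_le.1 hx).le
    exact absurd (csInf_le hbd this) (not_le.2 hcs)
  refine ⟨s, hs1, hsle, ?_⟩
  have hprod : ∀ᵐ p : I × I, ∀ b c : ℚ, (1 : ℝ) < b → (c : ℝ) < s →
      ¬ ((((b : ℝ)⁻¹ ≤ g p.1 / f p.1 ∧ g p.1 / f p.1 < 1)) ∧
        ((b : ℝ) ≤ g p.2 / f p.2 ∧ g p.2 / f p.2 < c)) := by
    refine ae_all_iff.2 fun b => ae_all_iff.2 fun c => ?_
    by_cases hb : (1 : ℝ) < b
    swap
    · exact Eventually.of_forall fun p h => absurd h hb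
    by_cases hc : (c : ℝ) < s
    swap
    · exact Eventually.of_forall fun p _ h => absurd h hc
    have hc' := htop (max 1 (((c : ℝ) + s) / 2))
    by_cases hs2 : 1 < s
    swap
    · -- above the level `1` there is nothing
      have hs3 : s = 1 := le_antisymm (not_lt.1 hs2) hs1
      refine Eventually.of_forall fun p _ _ h => ?_
      linarith [h.2.1, h.2.2]
    have hlt : max 1 (((c : ℝ) + s) / 2) < s := max_lt hs2 (by linarith)
    have hcc : (c : ℝ) < max 1 (((c : ℝ) + s) / 2) := lt_max_of_lt_right (by linarith)
    rw [Measure.volume_eq_prod]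
    rcases hW.three_levels hf hg hf0 hb hcc (hc' (le_max_left _ _) hlt) with h | h
    · filter_upwards [Measure.quasiMeasurePreserving_fst.ae (measure_eq_zero_iff_ae_notMem.1 h)]
        with p hp _ _ hcon
      exact hp hcon.1
    · filter_upwards [Measure.quasiMeasurePreserving_snd.ae (measure_eq_zero_iff_ae_notMem.1 h)]
        with p hp _ _ hcon
      exact hp hcon.2
  filter_upwards [hprod, hW.ae_ratio hf hg hf0] with p hp hr h1 h2 h0
  rcases hr with ⟨hr, -⟩ | ⟨hr, -⟩
  · exact hr
  exfalso
  set x := g p.1 / f p.1 with hx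
  set y := g p.2 / f p.2 with hy
  have hx0 : 0 < x := by
    rcases eq_or_lt_of_le h0 with h | h
    · rw [← h] at hr; linarith
    · exact h
  obtain ⟨b, hb1, hb2⟩ := exists_rat_btwn (show x⁻¹ < y by
    rw [inv_lt_iff_one_lt_mul₀ hx0]; linarith)
  obtain ⟨c, hc1, hc2⟩ := exists_rat_btwn h2
  have hb : (1 : ℝ) < b := ((one_lt_inv₀ hx0).2 h1).trans hb1
  exact hp b c hb hc2 ⟨⟨(inv_lt_of_inv_lt₀ hx0 hb1).le, h1⟩, hb2.le, hc1⟩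

end IsExtremal
end Graphon

/-! ### Rearrangement into intervals -/

namespace Graphon

theorem block_unique {t : Fin 8 → ℝ} (ht : Monotone t) {x : I} {i j : Fin 7}
    (hi : x ∈ block t i) (hj : x ∈ block t j) : i = j := by
  have key : ∀ {i j : Fin 7}, x ∈ block t i → x ∈ block t j → ¬ i < j := by
    intro i j hi hj hij
    have h1 : t i.succ ≤ t j.castSucc := ht (by
      rw [Fin.le_def]; simp only [Fin.val_succ, Fin.val_castSucc]; exact hij)
    exact absurd hi.2 (not_lt.2 (h1.trans hj.1))
  exact le_antisymm (not_lt.1 (key hj hi)) (not_lt.1 (key hi hj))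

theorem step_eq_pattern {t : Fin 8 → ℝ} (ht : Monotone t) {x y : I} {i j : Fin 7}
    (hi : x ∈ block t i) (hj : y ∈ block t j) : step t x y = pattern i j := by
  rw [step, Finset.sum_eq_single i, Finset.sum_eq_single j]
  · simp [hi, hj]
  · intro b _ hb
    have : y ∉ block t b := fun h => hb (block_unique ht h hj)
    simp [this]
  · simp
  · intro b _ hb
    have : x ∉ block t b := fun h => hb (block_unique ht h hi)
    simp [this]
  · simp

/-- The probability integral transform: the distribution function of a probability measure without
atoms has the uniform distribution. -/
theorem measure_cdf_le (ρ : Measure ℝ) [IsProbabilityMeasure ρ] (hρ : ∀ a, ρ {a} = 0) {s : ℝ}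
    (hs : s ∈ I) : ρ {a | ρ.real (Set.Iic a) ≤ s} = ENNReal.ofReal s := by
  simp only [← ProbabilityTheory.cdf_eq_real]
  set F := ProbabilityTheory.cdf ρ with hF
  have hcont : Continuous F := by
    refine continuous_iff_continuousAt.2 fun a => ?_
    rw [(F.mono).continuousAt_iff_leftLim_eq_rightLim, F.rightLim_eq]
    have h1 := F.measure_singleton a
    rw [hF, ProbabilityTheory.measure_cdf, hρ a, eq_comm, ENNReal.ofReal_eq_zero] at h1
    exact le_antisymm (F.mono.leftLim_le le_rfl) (by linarith)
  rcases eq_or_lt_of_le hs.2 with h1 | h1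
  · have : {a | F a ≤ s} = Set.univ :=
      Set.eq_univ_of_forall fun a => by
        rw [h1]; exact ProbabilityTheory.cdf_le_one ρ a
    rw [this, h1]; simp
  rcases Set.eq_empty_or_nonempty {a | F a ≤ s} with h2 | h2
  · have h3 : s ≤ 0 := by
      refine ge_of_tendsto (ProbabilityTheory.tendsto_cdf_atBot ρ) (Eventually.of_forall fun a => ?_)
      have : a ∉ {a | F a ≤ s} := by rw [h2]; exact Set.notMem_empty a
      exact (not_le.1 this).le
    rw [h2, measure_empty, ENNReal.ofReal_of_nonpos h3]
  · have hbdd : BddAbove {a | F a ≤ s} := by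
      obtain ⟨b, hb⟩ := ((ProbabilityTheory.tendsto_cdf_atTop ρ).eventually_const_lt h1).exists
      refine ⟨b, fun a ha => ?_⟩
      by_contra h
      have h3 : F a ≤ s := ha
      exact absurd (hb.trans_le (F.mono (not_le.1 h).le)) (not_lt.2 h3)
    set y := sSup {a | F a ≤ s} with hy
    have hyle : F y ≤ s :=
      (isClosed_le hcont continuous_const).csSup_mem h2 hbdd
    have hset : {a | F a ≤ s} = Set.Iic y := by
      ext a
      exact ⟨fun ha => le_csSup hbdd ha, fun ha => (F.mono ha).trans hyle⟩
    have hyge : s ≤ F y := by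
      refine ge_of_tendsto (hcont.continuousAt.tendsto.mono_left (nhdsWithin_le_nhds (s := Set.Ioi y)))
        ?_
      filter_upwards [self_mem_nhdsWithin] with a ha
      have : a ∉ {a | F a ≤ s} := by
        rw [hset]; exact fun h => absurd (Set.mem_Iic.1 h) (not_le.2 ha)
      exact (not_le.1 this).le
    rw [hset, ← ProbabilityTheory.ofReal_cdf, ← hF, le_antisymm hyle hyge]

/-- The classes of a measurable function `k` can be rearranged into consecutive intervals: send `x` to
the measure of the set of points that precede it in the lexicographic order of `(k(x), x)`. -/
theorem exists_measurePreserving_block {k : I → Fin 7} (hk : Measurable k) :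
    ∃ (t : Fin 8 → ℝ) (φ : I → I), IsCuts t ∧ MeasurePreserving φ volume volume ∧
      ∀ᵐ x, φ x ∈ block t (k x) := by
  set t : Fin 8 → ℝ := fun j => volume.real {x : I | (k x : ℕ) < j} with ht
  have hkn : Measurable fun x => (k x : ℕ) := (measurable_of_countable _).comp hk
  have hcuts : IsCuts t := by
    refine ⟨fun i j hij => ?_, ?_, ?_⟩
    · refine measureReal_mono ?_
      intro x hx
      exact lt_of_lt_of_le (show (k x : ℕ) < i from hx) hij
    · simp [ht]
    · have : {x : I | (k x : ℕ) < ((7 : Fin 8) : ℕ)} = Set.univ :=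
        Set.eq_univ_of_forall fun x => (k x).2
      simp only [ht, this, probReal_univ]
  -- the lexicographic order of `(k x, x)`, embedded in the real line
  set h : I → ℝ := fun x => 2 * ((k x : ℕ) : ℝ) + x with hh
  have hhm : Measurable h := by
    have : Measurable fun x : I => ((k x : ℕ) : ℝ) := (measurable_of_countable _).comp hkn
    exact (this.const_mul 2).add measurable_subtype_coe
  have hinj : Function.Injective h := by
    intro x y hxy
    have hx := x.2
    have hy := y.2
    simp only [hh] at hxy
    have : (k x : ℕ) = (k y : ℕ) := by
      by_contra hne
      rcases lt_or_gt_of_ne hne with h1 | h1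
      · have : ((k x : ℕ) : ℝ) + 1 ≤ ((k y : ℕ) : ℝ) := by exact_mod_cast h1
        linarith [hx.2, hy.1]
      · have : ((k y : ℕ) : ℝ) + 1 ≤ ((k x : ℕ) : ℝ) := by exact_mod_cast h1
        linarith [hx.1, hy.2]
    rw [this] at hxy
    exact Subtype.ext (by linarith)
  set ρ : Measure ℝ := volume.map h with hρ
  have hprob : IsProbabilityMeasure ρ := Measure.isProbabilityMeasure_map hhm.aemeasurable
  have hatom : ∀ a, ρ {a} = 0 := by
    intro a
    rw [hρ, Measure.map_apply hhm (measurableSet_singleton a)]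
    exact (Set.subsingleton_singleton.preimage hinj).measure_zero _
  set F : ℝ → ℝ := fun a => ρ.real (Set.Iic a) with hF
  have hFmono : Monotone F := fun a b hab => measureReal_mono (Set.Iic_subset_Iic.2 hab)
  have hF01 : ∀ a, F a ∈ I := fun a => ⟨measureReal_nonneg, measureReal_le_one⟩
  set φ : I → I := fun x => ⟨F (h x), hF01 _⟩ with hφ
  have hφm : Measurable φ := (hFmono.measurable.comp hhm).subtype_mk
  have hmap : volume.map φ = (volume : Measure I) := by
    have : IsProbabilityMeasure (volume.map φ) := Measure.isProbabilityMeasure_map hφm.aemeasurable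
    refine Measure.ext_of_Iic _ _ fun s => ?_
    rw [unitInterval.volume_Iic, Measure.map_apply hφm measurableSet_Iic]
    have hset : φ ⁻¹' Set.Iic s = h ⁻¹' {a | F a ≤ s} := rfl
    rw [hset, ← Measure.map_apply hhm (measurableSet_le hFmono.measurable measurable_const)]
    exact measure_cdf_le ρ hatom s.2
  refine ⟨t, φ, hcuts, ⟨hφm, hmap⟩, ?_⟩
  have hval : ∀ x, (φ x : ℝ) = volume.real {y | h y ≤ h x} := by
    intro x
    simp only [hφ, hF, hρ]
    rw [map_measureReal_apply hhm measurableSet_Iic]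
    rfl
  have hne : ∀ᵐ x, ∀ j, (φ x : ℝ) ≠ t j := by
    refine ae_all_iff.2 fun j => ?_
    have h1 : ∀ᵐ z : I, (z : ℝ) ≠ t j := by
      have : volume {z : I | (z : ℝ) = t j} = 0 :=
        Set.Subsingleton.measure_zero (fun a ha b hb => Subtype.ext (Eq.trans ha (Eq.symm hb))) _
      exact measure_eq_zero_iff_ae_notMem.1 this
    rw [← hmap] at h1
    exact ae_of_ae_map hφm.aemeasurable h1
  filter_upwards [hne] with x hx
  refine ⟨?_, lt_of_le_of_ne ?_ (hx _)⟩
  · rw [hval x]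
    refine measureReal_mono ?_
    intro y hy
    have h1 : (k y : ℕ) < (k x : ℕ) := by simpa using hy
    have h2 : ((k y : ℕ) : ℝ) + 1 ≤ ((k x : ℕ) : ℝ) := by exact_mod_cast h1
    change 2 * ((k y : ℕ) : ℝ) + y ≤ 2 * ((k x : ℕ) : ℝ) + x
    linarith [y.2.2, x.2.1]
  · rw [hval x]
    refine measureReal_mono ?_
    intro y hy
    have h1 : 2 * ((k y : ℕ) : ℝ) + y ≤ 2 * ((k x : ℕ) : ℝ) + x := hy
    change (k y : ℕ) < ((k x).succ : ℕ)
    rw [Fin.val_succ]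
    by_contra hcon
    have h2 : ((k x : ℕ) : ℝ) + 1 ≤ ((k y : ℕ) : ℝ) := by exact_mod_cast not_lt.1 hcon
    linarith [y.2.1, x.2.2]

end Graphon

/-! ### The classification of the points -/

namespace Graphon

open Classical in
/-- The four classes `t < 1/s`, `1/s ≤ t < 1`, `1 ≤ t < s` and `t ≥ s` of a nonnegative level `t`, where
`s` is the top level. -/
noncomputable def level (s t : ℝ) : ℕ :=
  if t < s⁻¹ then 0 else if t < 1 then 1 else if t < s then 2 else 3

theorem level_le (s t : ℝ) : level s t ≤ 3 := by
  unfold level; split_ifs <;> omega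

theorem measurable_level (s : ℝ) : Measurable (level s) :=
  Measurable.ite measurableSet_Iio measurable_const
    (Measurable.ite measurableSet_Iio measurable_const
      (Measurable.ite measurableSet_Iio measurable_const measurable_const))

/-- For levels with the properties of `IsExtremal.exists_top_level`, adjacency is the threshold rule
on the classes. -/
theorem mul_lt_one_iff_level {s t u : ℝ} (hs : 1 ≤ s) (ht0 : 0 ≤ t) (hu0 : 0 ≤ u) (hts : t ≤ s)
    (hus : u ≤ s) (hne : t * u ≠ 1) (h1 : t < 1 → u < s → t * u < 1)
    (h2 : u < 1 → t < s → u * t < 1) : t * u < 1 ↔ level s t + level s u ≤ 3 := by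
  have hs0 : 0 < s := by linarith
  have hinv : ∀ {a : ℝ}, a < s⁻¹ ↔ a * s < 1 := fun {a} => by
    rw [← one_div, lt_div_iff₀ hs0]
  rw [mul_comm u t] at h2
  unfold level
  simp only [hinv]
  split_ifs with a1 a2 a3 a4 a5 a6 a7 a8 a9 a10 a11 a12 a13 a14 a15 <;>
    first
    | (refine iff_of_true ?_ (by norm_num); first | exact h1 (by assumption) (by assumption) | exact h2 (by assumption) (by assumption) | nlinarith)
    | (refine iff_of_false ?_ (by norm_num); intro hc; apply hne; refine le_antisymm hc.le ?_; nlinarith)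

theorem pattern_apply (i j : Fin 7) : pattern i j =
    if ((i : ℕ) < 4 ∧ (j : ℕ) < 4 ∧ 3 < (i : ℕ) + j) ∨ (4 ≤ (i : ℕ) ∧ 4 ≤ (j : ℕ) ∧ 9 < (i : ℕ) + j)
    then 0 else 1 := by
  fin_cases i <;> fin_cases j <;> simp [pattern]

namespace IsExtremal

variable {W : Graphon} (hW : W.IsExtremal)
variable {f g : I → ℝ} (hf : W.UnitEigen W.maxEigenvalue f) (hg : W.UnitEigen W.minEigenvalue g)
include hW hf hg

/-- The classification of the points. Those with `g ≥ 0` are divided according to the level of `g / f`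
into the classes `0, …, 3`, those with `g < 0` according to the level of `-g / f` into the classes
`4, 5, 6`. The lowest class does not occur for the latter. -/
theorem exists_class (hf0 : ∀ x, 0 ≤ f x) (hgi : ∫ x, g x ≤ 0) :
    ∃ k : I → Fin 7, Measurable k ∧ (∀ᵐ p : I × I, W.toFun p.1 p.2 = pattern (k p.1) (k p.2)) ∧
      ∀ᵐ x, ((k x : ℕ) < 4 → 0 ≤ g x) ∧ (4 ≤ (k x : ℕ) → g x < 0) := by
  classical
  have hν := hW.minEigenvalue_neg
  obtain ⟨s, hs1, hs, hs2⟩ := hW.exists_top_level hf hg hf0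
  obtain ⟨s', hs1', hs', hs2'⟩ := hW.exists_top_level hf hg.neg hf0
  have hpos := hW.ae_pos hf hg hf0
  have hrule := hW.ae_ratio hf hg hf0
  set r : I → ℝ := fun x => g x / f x with hr
  have hneg : ∀ x, (-g) x / f x = -r x := fun x => by simp only [hr, Pi.neg_apply, neg_div]
  simp only [hneg] at hs' hs2'
  change ∀ᵐ x, r x ≤ s at hs
  change ∀ᵐ p : I × I, r p.1 < 1 → r p.2 < s → 0 ≤ r p.1 → r p.1 * r p.2 < 1 at hs2
  change ∀ᵐ p : I × I, (r p.1 * r p.2 < 1 ∧ W.toFun p.1 p.2 = 1) ∨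
    (1 < r p.1 * r p.2 ∧ W.toFun p.1 p.2 = 0) at hrule
  have hrm : Measurable r := hg.bdd.1.div hf.bdd.1
  set n : I → ℕ := fun x => if 0 ≤ g x then level s (r x) else 3 + level s' (-r x) with hn
  have hnm : Measurable n := Measurable.ite (measurableSet_le measurable_const hg.bdd.1)
    ((measurable_level s).comp hrm) (((measurable_level s').comp hrm.neg).const_add 3)
  have hn7 : ∀ x, n x < 7 := by
    intro x
    have h1 := level_le s (r x)
    have h2 := level_le s' (-r x)
    simp only [hn]
    split_ifs <;> omega
  set k : I → Fin 7 := fun x => ⟨n x, hn7 x⟩ with hk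
  have hkm : Measurable k := by
    refine measurable_to_countable' fun i => ?_
    have : k ⁻¹' {i} = n ⁻¹' {(i : ℕ)} := by
      ext x; simp [hk, Fin.ext_iff]
    rw [this]
    exact hnm (measurableSet_singleton _)
  have hsign : ∀ᵐ x, (0 ≤ g x ↔ 0 ≤ r x) := by
    filter_upwards [hpos] with x hx
    constructor
    · intro h; exact div_nonneg h hx.le
    · intro h
      by_contra hcon
      exact absurd h (not_le.2 (div_neg_of_neg_of_pos (not_le.1 hcon) hx))
  -- a negative point adjacent to everything would give `ν g = ∫ g ≤ 0`
  have hlev : ∀ᵐ x, g x < 0 → level s' (-r x) ≠ 0 := by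
    have hrows : ∀ᵐ x : I, ∀ᵐ y : I, (r x * r y < 1 ∧ W.toFun x y = 1) ∨
        (1 < r x * r y ∧ W.toFun x y = 0) := Measure.ae_ae_of_ae_prod hrule
    filter_upwards [hrows, hsign] with x hx hsx hgx hl
    have hrx : r x < 0 := not_le.1 fun h => absurd (hsx.2 h) (not_le.2 hgx)
    have hlt : -r x < s'⁻¹ := by
      by_contra h
      unfold level at hl
      rw [if_neg h] at hl
      split_ifs at hl
    have h1 : -r x * s' < 1 := by
      rwa [← one_div, lt_div_iff₀ (by linarith)] at hlt
    have hop : W.op g x = ∫ y, g y := by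
      refine integral_congr_ae ?_
      filter_upwards [hx, hs'] with y hy hy'
      have : r x * r y < 1 := by nlinarith
      rcases hy with ⟨-, hy⟩ | ⟨hy, -⟩
      · simp [hy]
      · linarith
    rw [hg.op_eq] at hop
    have := mul_pos_of_neg_of_neg hν hgx
    linarith
  have hsx : ∀ᵐ x, r x ≤ s ∧ -r x ≤ s' ∧ (0 ≤ g x ↔ 0 ≤ r x) ∧
      (g x < 0 → level s' (-r x) ≠ 0) := by
    filter_upwards [hs, hs', hsign, hlev] with x h1 h2 h3 h4 using ⟨h1, h2, h3, h4⟩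
  have hswap : ∀ {P : I × I → Prop}, (∀ᵐ p : I × I, P p) → ∀ᵐ p : I × I, P p.swap := by
    intro P hP
    rw [Measure.volume_eq_prod] at hP ⊢
    exact Measure.measurePreserving_swap.quasiMeasurePreserving.ae hP
  have hboth : ∀ {P : I → Prop}, (∀ᵐ x, P x) → ∀ᵐ p : I × I, P p.1 ∧ P p.2 := by
    intro P hP
    rw [Measure.volume_eq_prod]
    exact (Measure.quasiMeasurePreserving_fst.ae hP).and
      (Measure.quasiMeasurePreserving_snd.ae hP)
  refine ⟨k, hkm, ?_, ?_⟩
  · filter_upwards [hboth hsx, hrule, hs2, hswap hs2, hs2', hswap hs2'] with p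
      hp hr h1 h2 h3 h4
    obtain ⟨⟨a1, a2, a3, a4⟩, b1, b2, b3, b4⟩ := hp
    have hne : r p.1 * r p.2 ≠ 1 := by
      rcases hr with ⟨hr, -⟩ | ⟨hr, -⟩
      · exact hr.ne
      · exact hr.ne'
    have hWr : W.toFun p.1 p.2 = if r p.1 * r p.2 < 1 then 1 else 0 := by
      rcases hr with ⟨hr, hw⟩ | ⟨hr, hw⟩
      · rw [hw, if_pos hr]
      · rw [hw, if_neg (not_lt.2 hr.le)]
    have hl := fun x => level_le s (r x)
    have hl' := fun x => level_le s' (-r x)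
    rw [hWr, pattern_apply]
    simp only [hk, hn]
    have hl1 := hl p.1
    have hl2 := hl p.2
    have hl1' := hl' p.1
    have hl2' := hl' p.2
    by_cases g1 : 0 ≤ g p.1 <;> by_cases g2 : 0 ≤ g p.2
    · have key := mul_lt_one_iff_level hs1 (a3.1 g1) (b3.1 g2) a1 b1 hne
        (fun ha hb => h1 ha hb (a3.1 g1)) (fun hb ha => h2 hb ha (b3.1 g2))
      rw [if_pos g1, if_pos g2]
      by_cases hlt : r p.1 * r p.2 < 1
      · rw [if_pos hlt, if_neg]
        have := key.1 hlt
        omega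
      · rw [if_neg hlt, if_pos]
        have := mt key.2 hlt
        omega
    · have r1 := a3.1 g1
      have r2 : r p.2 < 0 := not_le.1 (mt b3.2 g2)
      have := b4 (not_le.1 g2)
      rw [if_pos g1, if_neg g2, if_pos (by nlinarith), if_neg]
      omega
    · have r2 := b3.1 g2
      have r1 : r p.1 < 0 := not_le.1 (mt a3.2 g1)
      have := a4 (not_le.1 g1)
      rw [if_neg g1, if_pos g2, if_pos (by nlinarith), if_neg]
      omega
    · have r1 : r p.1 < 0 := not_le.1 (mt a3.2 g1)
      have r2 : r p.2 < 0 := not_le.1 (mt b3.2 g2)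
      have n1 := a4 (not_le.1 g1)
      have n2 := b4 (not_le.1 g2)
      have key := mul_lt_one_iff_level hs1' (t := -r p.1) (u := -r p.2) (by linarith) (by linarith)
        a2 b2 (by rwa [neg_mul_neg]) (fun ha hb => h3 ha hb (by linarith))
        (fun hb ha => h4 hb ha (by simp only [Prod.fst_swap]; linarith))
      rw [neg_mul_neg] at key
      rw [if_neg g1, if_neg g2]
      by_cases hlt : r p.1 * r p.2 < 1
      · rw [if_pos hlt, if_neg]
        have := key.1 hlt
        omega
      · rw [if_neg hlt, if_pos]
        have := mt key.2 hlt
        omega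
  · filter_upwards [hsx] with x ⟨_, _, _, h4⟩
    have h1 := level_le s (r x)
    simp only [hk, hn]
    by_cases g1 : 0 ≤ g x
    · rw [if_pos g1]
      exact ⟨fun _ => g1, fun h => by omega⟩
    · rw [if_neg g1]
      have := h4 (not_le.1 g1)
      exact ⟨fun h => by omega, fun _ => not_le.1 g1⟩

theorem ae_sq_eq {h : I → ℝ} (hh : W.UnitEigen W.minEigenvalue h) :
    ∀ᵐ x, h x ^ 2 = g x ^ 2 := by
  have hν := hW.minEigenvalue_neg
  filter_upwards [hW.ae_ellipse hf hg, hW.ae_ellipse hf hh] with x h1 h2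
  exact mul_left_cancel₀ hν.ne (by linarith)

/-- The eigenvalue `ν(W)` is simple: by the ellipse identity any two of its unit eigenfunctions have the
same square. For orthogonal `g` and `e`, comparing with `(g + e) / √2` gives `g e = 0`, hence
`g = 0`. -/
theorem exists_ae_eq_smul {h : I → ℝ} (hh : W.IsEigenfunction W.minEigenvalue h) :
    ∃ c : ℝ, c ≠ 0 ∧ h =ᵐ[volume] c • g := by
  have hν := hW.minEigenvalue_neg
  have hm := hW.measurable
  obtain ⟨a, h', ha, hh', hah⟩ := W.exists_unitEigen hm hν.ne hh
  set c := ip g h' with hc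
  set q : I → ℝ := h' + (-c) • g with hq
  have hqb : IsBdd q := hh'.bdd.add (hg.bdd.smul _)
  have hqop : ∀ x, W.op q x = W.minEigenvalue * q x := by
    intro x
    rw [hq, W.op_add hm hh'.bdd (hg.bdd.smul _), op_smul]
    simp only [Pi.add_apply, Pi.smul_apply, smul_eq_mul, hh'.op_eq, hg.op_eq]
    ring
  have hgq : ip g q = 0 := by
    rw [hq, ip_add_right hh'.bdd (hg.bdd.smul _) hg.bdd, ip_smul_right, hg.norm, ← hc]
    ring
  have hz : ip q q = 0 := by
    by_contra hne
    have hpos : 0 < ip q q := lt_of_le_of_ne (ip_self_nonneg q) (Ne.symm hne)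
    have hs : 0 < Real.sqrt (ip q q) := Real.sqrt_pos.2 hpos
    set e : I → ℝ := (Real.sqrt (ip q q))⁻¹ • q with he
    have hee : W.UnitEigen W.minEigenvalue e := by
      refine ⟨hqb.smul _, fun x => ?_, ?_⟩
      · rw [he, op_smul]
        simp only [Pi.smul_apply, smul_eq_mul, hqop]; ring
      · rw [he, ip_smul_left, ip_smul_right, ← mul_assoc, ← mul_inv, Real.mul_self_sqrt hpos.le,
          inv_mul_cancel₀ hpos.ne']
    have hge : ip g e = 0 := by rw [he, ip_smul_right, hgq, mul_zero]
    have hsum : W.UnitEigen W.minEigenvalue ((Real.sqrt 2)⁻¹ • (g + e)) := by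
      refine ⟨(hg.bdd.add hee.bdd).smul _, fun x => ?_, ?_⟩
      · rw [op_smul, W.op_add hm hg.bdd hee.bdd]
        simp only [Pi.smul_apply, Pi.add_apply, smul_eq_mul, hg.op_eq, hee.op_eq]; ring
      · rw [ip_smul_left, ip_smul_right, ip_add_left hg.bdd hee.bdd (hg.bdd.add hee.bdd),
          ip_add_right hg.bdd hee.bdd hg.bdd, ip_add_right hg.bdd hee.bdd hee.bdd, hg.norm,
          hee.norm, ip_comm e g, hge, ← mul_assoc, ← mul_inv,
          Real.mul_self_sqrt (by norm_num)]
        norm_num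
    have h0 : g =ᵐ[volume] 0 := by
      filter_upwards [hW.ae_sq_eq hf hg hee, hW.ae_sq_eq hf hg hsum] with x h1 h2
      simp only [Pi.smul_apply, Pi.add_apply, smul_eq_mul, mul_pow, inv_pow] at h2
      rw [Real.sq_sqrt (by norm_num)] at h2
      have h3 : g x * e x = 0 := by nlinarith
      have h4 : g x ^ 4 = 0 := by
        calc g x ^ 4 = g x ^ 2 * e x ^ 2 := by rw [h1]; ring
          _ = (g x * e x) ^ 2 := by ring
          _ = 0 := by rw [h3]; ring
      simpa using h4
    have h1 := hg.norm
    rw [ip_congr h0 h0] at h1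
    simp [ip] at h1
  have hq0 := ae_eq_zero_of_ip_self hqb.memLp hz
  have hhc : h' =ᵐ[volume] c • g := by
    filter_upwards [hq0] with x hx
    simp only [hq, Pi.add_apply, Pi.smul_apply, smul_eq_mul, Pi.zero_apply] at hx ⊢
    linarith
  refine ⟨a * c, ?_, ?_⟩
  · refine mul_ne_zero ha.ne' fun hc0 => ?_
    have h1 := hh'.norm
    rw [ip_congr hhc hhc, hc0] at h1
    simp [ip] at h1
  · filter_upwards [hah, hhc] with x h1 h2
    simp only [Pi.smul_apply, smul_eq_mul] at h1 h2 ⊢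
    rw [h1, h2]; ring

end IsExtremal

/-- Every graphon agrees almost everywhere with one whose kernel is Borel measurable; the two have the
same eigenfunctions. -/
theorem exists_measurable_version (W : Graphon) : ∃ V : Graphon,
    (Measurable fun p : I × I => V.toFun p.1 p.2) ∧
    (∀ᵐ p : I × I, W.toFun p.1 p.2 = V.toFun p.1 p.2) ∧
    ∀ c f, W.IsEigenfunction c f ↔ V.IsEigenfunction c f := by
  set w := W.aemeasurable'.mk with hw
  have hwm : Measurable w := W.aemeasurable'.measurable_mk
  have hwW : ∀ᵐ p : I × I, W.toFun p.1 p.2 = w p := W.aemeasurable'.ae_eq_mk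
  have hVm : Measurable fun p : I × I => max 0 (min 1 ((w (p.1, p.2) + w (p.2, p.1)) / 2)) :=
    measurable_const.max (measurable_const.min (((hwm.comp (measurable_fst.prodMk measurable_snd)).add
      (hwm.comp (measurable_snd.prodMk measurable_fst))).div_const 2))
  set V : Graphon :=
    { toFun := fun x y => max 0 (min 1 ((w (x, y) + w (y, x)) / 2))
      aemeasurable' := hVm.aemeasurable
      symm' := fun x y => by rw [add_comm]
      mem_Icc' := fun x y => ⟨le_max_left _ _, max_le zero_le_one (min_le_left _ _)⟩ } with hV
  have hswap : ∀ᵐ p : I × I, W.toFun p.2 p.1 = w p.swap := by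
    rw [Measure.volume_eq_prod] at hwW ⊢
    exact Measure.measurePreserving_swap.quasiMeasurePreserving.ae hwW
  have hWV : ∀ᵐ p : I × I, W.toFun p.1 p.2 = V.toFun p.1 p.2 := by
    filter_upwards [hwW, hswap] with p h1 h2
    change _ = max 0 (min 1 ((w p + w p.swap) / 2))
    rw [← h1, ← h2, W.symm' p.2 p.1, add_self_div_two, min_eq_right (W.mem_Icc' _ _).2,
      max_eq_right (W.mem_Icc' _ _).1]
  refine ⟨V, hVm, hWV, fun c f => ?_⟩
  have hop : ∀ᵐ x, W.op f x = V.op f x := by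
    have hrow : ∀ᵐ x : I, ∀ᵐ y : I, W.toFun x y = V.toFun x y := Measure.ae_ae_of_ae_prod hWV
    filter_upwards [hrow] with x hx
    refine integral_congr_ae ?_
    filter_upwards [hx] with y hy
    rw [hy]
  refine and_congr_right fun _ => and_congr_right fun _ => ?_
  exact eventually_congr (hop.mono fun x hx => by rw [hx])

end Graphon

theorem theorem4p1 (W : Graphon) (hW : ∀ U : Graphon, U.spread ≤ W.spread) :
    ∃ (t : Fin 8 → ℝ) (φ : I → I),
      Graphon.IsCuts t ∧
      MeasurePreserving φ volume volume ∧
      (∀ᵐ p : I × I, W.toFun p.1 p.2 = Graphon.step t (φ p.1) (φ p.2)) ∧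
      (∃ g : I → ℝ, W.IsEigenfunction W.minEigenvalue g) ∧
      ∀ g : I → ℝ, W.IsEigenfunction W.minEigenvalue g →
        ∃ s : ℝ, (s = 1 ∨ s = -1) ∧
          ∀ᵐ x : I, ∀ i : Fin 7, φ x ∈ Graphon.block t i →
            ((i : ℕ) < 4 → 0 ≤ s * g x) ∧ (4 ≤ (i : ℕ) → s * g x < 0) := by
  obtain ⟨V, hVm, hWV, heig⟩ := W.exists_measurable_version
  have hev : W.eigenvalues = V.eigenvalues := by
    ext c; exact exists_congr fun f => heig c f
  have hmin : W.minEigenvalue = V.minEigenvalue := by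
    rw [Graphon.minEigenvalue, Graphon.minEigenvalue, hev]
  have hspread : W.spread = V.spread := by
    rw [Graphon.spread, Graphon.spread, Graphon.maxEigenvalue, Graphon.maxEigenvalue, hmin, hev]
  have hV : V.IsExtremal := ⟨hVm, fun U => hspread ▸ hW U⟩
  obtain ⟨f, hf, hf0⟩ := hV.exists_nonneg_unitEigen
  obtain ⟨hν, ⟨g₁, hg₁⟩, -⟩ := hV.minEigenvalue_facts
  obtain ⟨-, g₂, -, hg₂, -⟩ := V.exists_unitEigen hVm hν.ne hg₁
  obtain ⟨g, hg, hgi⟩ : ∃ g, V.UnitEigen V.minEigenvalue g ∧ ∫ x, g x ≤ 0 := by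
    rcases le_total (∫ x, g₂ x) 0 with h | h
    · exact ⟨g₂, hg₂, h⟩
    · refine ⟨-g₂, hg₂.neg, ?_⟩
      have : ∫ x, (-g₂) x = -∫ x, g₂ x := integral_neg g₂
      linarith
  obtain ⟨k, hkm, hkW, hks⟩ := hV.exists_class hf hg hf0 hgi
  obtain ⟨t, φ, ht, hφ, hφk⟩ := Graphon.exists_measurePreserving_block hkm
  refine ⟨t, φ, ht, hφ, ?_, ⟨g₁, (heig _ _).2 (hmin ▸ hg₁)⟩, fun h hh => ?_⟩
  · have hφ2 : ∀ᵐ p : I × I, φ p.1 ∈ Graphon.block t (k p.1) ∧ φ p.2 ∈ Graphon.block t (k p.2) := by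
      rw [Measure.volume_eq_prod]
      exact (Measure.quasiMeasurePreserving_fst.ae hφk).and
        (Measure.quasiMeasurePreserving_snd.ae hφk)
    filter_upwards [hWV, hkW, hφ2] with p h1 h2 h3
    rw [h1, h2, Graphon.step_eq_pattern ht.1 h3.1 h3.2]
  · obtain ⟨c, hc, hhc⟩ := hV.exists_ae_eq_smul hf hg (hmin ▸ (heig _ _).1 hh)
    obtain ⟨s, hs, hsc⟩ : ∃ s : ℝ, (s = 1 ∨ s = -1) ∧ 0 < s * c := by
      rcases lt_or_gt_of_ne hc with h0 | h0
      · exact ⟨-1, Or.inr rfl, by linarith⟩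
      · exact ⟨1, Or.inl rfl, by linarith⟩
    refine ⟨s, hs, ?_⟩
    filter_upwards [hhc, hφk, hks] with x h1 h2 h3 i hi
    have hik : i = k x := Graphon.block_unique ht.1 hi h2
    have h4 : s * h x = (s * c) * g x := by
      rw [h1, Pi.smul_apply, smul_eq_mul]; ring
    rw [h4, hik]
    exact ⟨fun hlt => mul_nonneg hsc.le (h3.1 hlt), fun hge => mul_neg_of_pos_of_neg hsc (h3.2 hge)⟩
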